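/- For $n\ge 0$ let $\mathrm{Av}^\star_{3n}(132)$ be the set of permutations $\pi=\pi_1\cdots\pi_{3n}$ of $[3n]=\{1,\dots,3n\}$ whose cycle decomposition consists only of $3$-cycles (so there are no fixed points) and that avoid the pattern $132$, i.e. there are no $i<j<k$ with $\pi_i<\pi_k<\pi_j$. Let $\mathcal{A}_{3n}\subseteq \mathrm{Av}^\star_{3n}(132)$ be the subset of those $\pi$ all of whose cycles are of the form $312$, meaning that if $\{p<q<r\}$ is the underlying set of a cycle of $\pi$, then $\pi_p=r$, $\pi_q=p$ and $\pi_r=q$. Put $a_m=|\mathcal{A}_{3m}|$. Then for all $n\ge 1$, \[ |\mathrm{Av}^\star_{3n}(132)| = 2\sum_{(x_1,\dots,x_k)} a_{x_1}a_{x_2}\cdots a_{x_k}, \] where the sum runs over all compositions $(x_1,\dots,x_k)$ of $n$ into positive integers, of every length $k\ge 1$. Furthermore, the generating function $B(x)=\sum_{n\ge 1}|\mathrm{Av}^\star_{3n}(132)|\,x^n$ is, as a formal power series, \[ B(x)=\frac{2A(x)}{1-A(x)},\qquad A(x)=(c(x)-1)\,m(c(x)-1), \] where $c(x)=\sum_{n\ge0}C_nx^n$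 is the generating function of the Catalan numbers $C_n$, and $m(x)=\sum_{n\ge 0}M_nx^n$ is the generating function of the Motzkin numbers: $M_n$ is the number of paths from $(0,0)$ to $(n,0)$ with steps $(1,1)$, $(1,0)$, $(1,-1)$ that never go below the $x$-axis. -/

import Mathlib

namespace ThreeCyclePerm

open Equiv

/-- The pattern `132` in one-line notation, on the letters `0, 1, 2` instead of `1, 2, 3`. -/
def pattern132 : Perm (Fin 3) := ⟨![0, 2, 1], ![0, 2, 1], by decide, by decide⟩

/-- The pattern `312` in one-line notation, on the letters `0, 1, 2` instead of `1, 2, 3`. -/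
def pattern312 : Perm (Fin 3) := ⟨![2, 0, 1], ![1, 2, 0], by decide, by decide⟩

/-- The values of `π` at the positions `f 0 < f 1 < ⋯ < f (k - 1)` are in the same relative order
as `σ`. -/
def IsOccurrence {n k : ℕ} (π : Perm (Fin n)) (σ : Perm (Fin k)) (f : Fin k ↪o Fin n) : Prop :=
  ∀ i j : Fin k, π (f i) < π (f j) ↔ σ i < σ j

/-- `π` avoids the pattern `σ`. -/
def Avoids {n k : ℕ} (π : Perm (Fin n)) (σ : Perm (Fin k)) : Prop :=
  ¬ ∃ f : Fin k ↪o Fin n, IsOccurrence π σ f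

/-- The permutations of `3n` letters that are composed of `n` disjoint `3`-cycles (and hence have
no fixed points). -/
def threeCyclePerms (n : ℕ) : Set (Perm (Fin (3 * n))) :=
  {π | π.cycleType = Multiset.replicate n 3}

/-- The permutations of `3n` letters that are composed only of `3`-cycles and avoid `σ`. -/
def avStar {k : ℕ} (n : ℕ) (σ : Perm (Fin k)) : Set (Perm (Fin (3 * n))) :=
  {π | π ∈ threeCyclePerms n ∧ Avoids π σ}

/-- The cycle `c` is of the form `σ`: its elements, listed as positions in increasing order, carry
values in the relative order of `σ`. -/
def CycleHasForm {n k : ℕ} (c : Perm (Fin n)) (σ : Perm (Fin k)) : Prop :=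
  ∃ f : Fin k ↪o Fin n, Set.range f = {i | i ∈ c.support} ∧ IsOccurrence c σ f

/-- The `132`-avoiding permutations of `3n` letters all of whose cycles are `3`-cycles of the form
`312`. -/
def setA (n : ℕ) : Set (Perm (Fin (3 * n))) :=
  {π | π ∈ avStar n pattern132 ∧ ∀ c ∈ π.cycleFactorsFinset, CycleHasForm c pattern312}

/-- The Motzkin paths of length `n`: sequences of `n` steps, up (`1`), flat (`0`) or down (`-1`),
from height `0` to height `0` that never go below height `0`. -/
def motzkinPaths (n : ℕ) : Set (Fin n → SignType) :=
  {s | (∀ k : ℕ, 0 ≤ ∑ i : Fin n with i.val < k, (s i : ℤ)) ∧ ∑ i : Fin n, (s i : ℤ) = 0}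

/-- The `n`-th Motzkin number. -/
noncomputable def motzkin (n : ℕ) : ℕ := (motzkinPaths n).ncard

/-- The generating function of the Catalan numbers. -/
noncomputable def catalanGF : PowerSeries ℚ := PowerSeries.mk fun n => (catalan n : ℚ)

/-- The generating function of the Motzkin numbers. -/
noncomputable def motzkinGF : PowerSeries ℚ := PowerSeries.mk fun n => (motzkin n : ℚ)

/-- The series `(c(x) - 1) m(c(x) - 1)`. The substitution is the genuine one, since `c(x) - 1` has
zero constant term. -/
noncomputable def seriesA : PowerSeries ℚ :=
  (catalanGF - 1) * PowerSeries.subst (catalanGF - 1) motzkinGF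

/-- The generating function of the number of `132`-avoiding permutations composed of `n`
`3`-cycles, over `n ≥ 1`. -/
noncomputable def seriesB : PowerSeries ℚ :=
  PowerSeries.mk fun n => if n = 0 then 0 else ((avStar n pattern132).ncard : ℚ)

end ThreeCyclePerm

/-!
Let `π` be a `132`-avoiding permutation with `n` cycles, all of length `3`. The smallest elements of
the cycles are the first `n` letters, and each cycle has the form `312` or `231`. If the cycles of
the letters `0, …, x - 1` have the form `312` and that of `x` has the form `231`, then all the
other cycles occupy a block of consecutive positions and values, so `π` is a permutation in `setA x`
with a permutation inserted whose first cycle has the form `231`. Inversion exchanges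
the two forms, so exactly half of the permutations start with a cycle of the form `312`; hence the
number of the others satisfies the recursion of the weighted sum over compositions.

A permutation in `setA n` consists of a monotone `α : Fin n → Fin n` below the identity, which tells
how the middle and the largest elements of the cycles are interleaved, and a `132`-avoiding `τ`,
which tells to which cycles they belong; the condition is that a non-inversion of `τ` only spans
positions where `α` neither jumps nor has a value. Reading jumps and values as a pair of bits turns
`α` into a Motzkin path with two kinds of flat steps, and non-inversions must span flat steps of one
kind only. Splitting at the maximum of `τ`, with a Catalan number of choices to the left of it,
gives for the series `P h` of such pairs, with the path starting at height `h`,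
`X * P h = (c - 1) * ([h = 0] + X * P (h - 1) + X * P h + X * P (h + 1))`. The Motzkin
series, with `c - 1` substituted and multiplied by `c - 1`, satisfy the same system, which has only
one solution because `c - 1` has constant term `0`.
-/

namespace ThreeCyclePerm

open Equiv

section Avoids132

/-- Avoidance of the pattern `132` by an arbitrary map between ordered types. -/
def Avoids132 {α β : Type*} [LT α] [LT β] (f : α → β) : Prop :=
  ∀ ⦃i j k⦄, i < j → j < k → f i < f k → ¬ f k < f j

theorem Avoids132.of_strictMono {α β γ δ : Type*} [Preorder α] [Preorder β] [Preorder γ]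
    [Preorder δ] {f : α → β} {f' : γ → δ} {g : γ → α} {h : δ → β} (hf : Avoids132 f)
    (hg : StrictMono g) (hh : StrictMono h) (hfg : ∀ x, f (g x) = h (f' x)) : Avoids132 f' := by
  intro i j k hij hjk hik hkj
  refine hf (hg hij) (hg hjk) ?_ ?_
  · simpa only [hfg] using hh hik
  · simpa only [hfg] using hh hkj

theorem Avoids132.inv {α : Type*} [LT α] {π : Perm α} (h : Avoids132 π) :
    Avoids132 (π⁻¹ : Perm α) := by
  intro i j k hij hjk hik hkj
  exact h hik hkj (by simpa using hij) (by simpa using hjk)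

theorem avoids_pattern132_iff {n : ℕ} {π : Perm (Fin n)} :
    Avoids π pattern132 ↔ Avoids132 π := by
  constructor
  · intro h i j k hij hjk hik hkj
    refine h ⟨OrderEmbedding.ofStrictMono ![i, j, k] (by simp [hij, hjk]), fun a b => ?_⟩
    fin_cases a <;> fin_cases b <;>
      simp [pattern132, hik, hkj, hik.trans hkj, hik.le, hkj.le, (hik.trans hkj).le]
  · rintro h ⟨f, hf⟩
    have h₀₁ : f 0 < f 1 := f.strictMono (by decide)
    have h₁₂ : f 1 < f 2 := f.strictMono (by decide)
    exact h h₀₁ h₁₂ ((hf 0 2).2 (by decide)) ((hf 2 1).2 (by decide))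

end Avoids132

section IsThreeCyclic

/-- The permutations all of whose cycles have length `3`, on a possibly infinite type. -/
structure IsThreeCyclic {α : Type*} (π : Perm α) : Prop where
  apply_ne : ∀ i, π i ≠ i
  apply_apply_apply : ∀ i, π (π (π i)) = i

variable {α : Type*} {π : Perm α}

theorem IsThreeCyclic.apply_apply_ne (h : IsThreeCyclic π) (i : α) : π (π i) ≠ i := fun e =>
  h.apply_ne i <| by simpa only [e] using h.apply_apply_apply i

theorem IsThreeCyclic.inv_apply (h : IsThreeCyclic π) (i : α) : π⁻¹ i = π (π i) :=
  Perm.inv_eq_iff_eq.2 (h.apply_apply_apply i).symm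

theorem IsThreeCyclic.inv (h : IsThreeCyclic π) : IsThreeCyclic π⁻¹ where
  apply_ne i := by simpa only [h.inv_apply] using h.apply_apply_ne i
  apply_apply_apply i := by simp only [h.inv_apply, h.apply_apply_apply]

theorem IsThreeCyclic.sameCycle_iff (h : IsThreeCyclic π) {i j : α} :
    π.SameCycle i j ↔ j = i ∨ j = π i ∨ j = π (π i) := by
  constructor
  · rintro ⟨k, rfl⟩
    induction k with
    | zero => simp
    | succ k ih =>
      rw [add_comm, zpow_one_add, Perm.mul_apply]
      rcases ih with ih | ih | ih <;> rw [ih] <;> simp [h.apply_apply_apply]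
    | pred k ih =>
      rw [sub_eq_neg_add, zpow_add, zpow_neg_one, Perm.mul_apply, h.inv_apply]
      rcases ih with ih | ih | ih <;> rw [ih] <;> simp [h.apply_apply_apply]
  · rintro (rfl | rfl | rfl) <;> simp only [Perm.sameCycle_apply_right, Perm.SameCycle.refl]

theorem cycleType_eq_replicate_three_iff [Fintype α] [DecidableEq α] {n : ℕ}
    (hα : Fintype.card α = 3 * n) :
    π.cycleType = Multiset.replicate n 3 ↔ IsThreeCyclic π := by
  have : Fact (Nat.Prime 3) := ⟨Nat.prime_three⟩
  have hcube : π ^ 3 = 1 ↔ ∀ i, π (π (π i)) = i := by simp [Equiv.ext_iff, pow_succ]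
  constructor
  · intro h
    have hsupp : π.support = Finset.univ := by
      rw [← Finset.card_eq_iff_eq_univ, ← Perm.sum_cycleType, h, hα]
      simp [mul_comm]
    refine ⟨fun i => Perm.mem_support.1 (by simp [hsupp]), hcube.1 ?_⟩
    exact Perm.pow_prime_eq_one_iff.2 fun c hc => Multiset.eq_of_mem_replicate (h ▸ hc)
  · intro h
    have hrep : π.cycleType = Multiset.replicate π.cycleType.card 3 :=
      Multiset.eq_replicate_card.2
        (Perm.pow_prime_eq_one_iff.1 (hcube.2 h.apply_apply_apply))
    have hsupp : π.support = Finset.univ := by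
      ext i
      simp [h.apply_ne]
    have hsum := π.sum_cycleType
    rw [hsupp, hrep, Multiset.sum_replicate, Finset.card_univ, hα, smul_eq_mul] at hsum
    rw [hrep, show π.cycleType.card = n by omega]

end IsThreeCyclic

section IsCycleMin

/-- In a permutation with all cycles of length `3`, `i` is the smallest element of its cycle. -/
def IsCycleMin {α : Type*} [LT α] (π : Perm α) (i : α) : Prop :=
  i < π i ∧ i < π (π i)

variable {α : Type*} [LinearOrder α] {π : Perm α}

theorem IsThreeCyclic.isCycleMin_apply_iff (h : IsThreeCyclic π) {i : α} :
    IsCycleMin π (π i) ↔ π i < π (π i) ∧ π i < i := by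
  rw [IsCycleMin, h.apply_apply_apply]

theorem IsThreeCyclic.isCycleMin_apply_apply_iff (h : IsThreeCyclic π) {i : α} :
    IsCycleMin π (π (π i)) ↔ π (π i) < i ∧ π (π i) < π i := by
  rw [IsCycleMin, h.apply_apply_apply]

theorem IsThreeCyclic.isCycleMin_or (h : IsThreeCyclic π) (i : α) :
    IsCycleMin π i ∨ IsCycleMin π (π i) ∨ IsCycleMin π (π (π i)) := by
  rw [h.isCycleMin_apply_iff, h.isCycleMin_apply_apply_iff, IsCycleMin]
  have := h.apply_ne i
  have := h.apply_ne (π i)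
  have := h.apply_apply_ne i
  grind

theorem IsThreeCyclic.exists_isCycleMin (h : IsThreeCyclic π) (i : α) :
    ∃ p, IsCycleMin π p ∧ (i = p ∨ i = π p ∨ i = π (π p)) := by
  have := h.apply_apply_apply
  rcases h.isCycleMin_or i with hi | hi | hi
  · exact ⟨i, hi, by simp⟩
  · exact ⟨π i, hi, by simp [this]⟩
  · exact ⟨π (π i), hi, by simp [this]⟩

theorem IsCycleMin.cycleHasForm_pattern312_iff {N : ℕ} {π : Perm (Fin N)} {p : Fin N}
    (hp : IsCycleMin π p) (h : IsThreeCyclic π) :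
    CycleHasForm (π.cycleOf p) pattern312 ↔ π (π p) < π p := by
  have hsupp (j : Fin N) : j ∈ (π.cycleOf p).support ↔ j = p ∨ j = π p ∨ j = π (π p) := by
    rw [Perm.mem_support_cycleOf_iff' (h.apply_ne p), h.sameCycle_iff]
  have hcyc (j : Fin N) (hj : j = p ∨ j = π p ∨ j = π (π p)) : π.cycleOf p j = π j :=
    (h.sameCycle_iff.2 hj).cycleOf_apply
  constructor
  · rintro ⟨f, hf, ho⟩
    have hmem (j : Fin N) (hj : j = p ∨ j = π p ∨ j = π (π p)) : ∃ a, f a = j := by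
      rw [← Set.mem_range, hf]
      exact (hsupp j).2 hj
    obtain ⟨a, ha⟩ := hmem p (by simp)
    obtain ⟨b, hb⟩ := hmem (π p) (by simp)
    obtain ⟨c, hc⟩ := hmem (π (π p)) (by simp)
    by_contra! hle
    have hab : a < b := f.lt_iff_lt.1 (by rw [ha, hb]; exact hp.1)
    have hbc : b < c := f.lt_iff_lt.1 (by rw [hb, hc]; exact hle.lt_of_ne (h.apply_ne _).symm)
    obtain rfl : a = 0 := by omega
    obtain rfl : b = 1 := by omega
    refine absurd ((ho 0 1).1 ?_) (by decide)
    rw [ha, hb, hcyc _ (by simp), hcyc _ (by simp)]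
    exact hle.lt_of_ne (h.apply_ne _).symm
  · intro hlt
    refine ⟨OrderEmbedding.ofStrictMono ![p, π (π p), π p] (by simp [hp.2, hlt]), ?_, ?_⟩
    · ext j
      rw [Set.mem_ofPred_eq, hsupp]
      simp [or_comm, or_left_comm]
    · intro a b
      fin_cases a <;> fin_cases b <;>
        simp [pattern312, hcyc, h.apply_apply_apply, hlt, hlt.le, hp.1, hp.2, hp.1.le, hp.2.le]

theorem IsThreeCyclic.forall_cycleHasForm_pattern312_iff {N : ℕ} {π : Perm (Fin N)}
    (h : IsThreeCyclic π) :
    (∀ c ∈ π.cycleFactorsFinset, CycleHasForm c pattern312) ↔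
      ∀ p, IsCycleMin π p → π (π p) < π p := by
  constructor
  · intro hc p hp
    refine (hp.cycleHasForm_pattern312_iff h).1 (hc _ ?_)
    exact Perm.cycleOf_mem_cycleFactorsFinset_iff.2 (Perm.mem_support.2 (h.apply_ne p))
  · intro hlt c hc
    obtain ⟨x, hx⟩ : c.support.Nonempty :=
      Finset.nonempty_iff_ne_empty.2 <| by
        simpa using (Perm.mem_cycleFactorsFinset_iff.1 hc).1.ne_one
    obtain ⟨p, hp, hxp⟩ := h.exists_isCycleMin x
    rw [Perm.cycle_is_cycleOf hx hc, ← (h.sameCycle_iff.2 hxp).cycleOf_eq,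
      hp.cycleHasForm_pattern312_iff h]
    exact hlt p hp

-- An element `a < i` with `π a < i` would be the `1` of a `132` together with any descent among
-- the elements `i`, `π i`, `π (π i)`, so `π` would increase along a cycle.
theorem IsCycleMin.le_apply_of_lt {a i : α} (hi : IsCycleMin π i) (h : IsThreeCyclic π)
    (hπ : Avoids132 π) (ha : a < i) : i ≤ π a := by
  by_contra! ha'
  have hmono (x y : α) (hx : i ≤ x) (hxy : x < y) (hy : i ≤ π y) : π x < π y :=
    (not_lt.1 (hπ (ha.trans_le hx) hxy (ha'.trans_le hy))).lt_of_ne (π.injective.ne hxy.ne)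
  have h₁ : π i < π (π i) := hmono _ _ le_rfl hi.1 hi.2.le
  have h₂ : π (π i) < i := by
    simpa only [h.apply_apply_apply] using
      hmono _ _ hi.1.le h₁ (h.apply_apply_apply i).ge
  exact hi.2.not_gt h₂

theorem isLowerSet_setOf_isCycleMin (h : IsThreeCyclic π) (hπ : Avoids132 π) :
    IsLowerSet {i | IsCycleMin π i} := by
  intro i j hji hi
  rcases hji.eq_or_lt with rfl | hji
  · exact hi
  refine ⟨hji.trans_le (hi.le_apply_of_lt h hπ hji), ?_⟩
  by_contra! hle
  have := hi.le_apply_of_lt h hπ (hle.trans_lt hji)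
  rw [h.apply_apply_apply] at this
  exact hji.not_ge this

theorem IsThreeCyclic.card_isCycleMin [Fintype α] [DecidablePred (IsCycleMin π)] {n : ℕ}
    (h : IsThreeCyclic π) (hα : Fintype.card α = 3 * n) :
    (Finset.univ.filter (IsCycleMin π)).card = n := by
  have hone (i : α) : (if IsCycleMin π i then 1 else 0) + (if IsCycleMin π (π i) then 1 else 0)
      + (if IsCycleMin π (π (π i)) then 1 else 0) = 1 := by
    have := h.isCycleMin_or i
    simp only [IsCycleMin, h.apply_apply_apply] at this ⊢
    grind
  have hsum := Finset.sum_congr (rfl : (Finset.univ : Finset α) = _) fun i _ => hone i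
  rw [Finset.sum_add_distrib, Finset.sum_add_distrib,
    Equiv.sum_comp π (fun i => if IsCycleMin π (π i) then 1 else 0),
    Equiv.sum_comp π (fun i => if IsCycleMin π i then 1 else 0), Finset.sum_const,
    Finset.card_univ, hα, smul_eq_mul] at hsum
  rw [Finset.card_filter]
  omega

theorem mem_iff_val_lt_card_of_isLowerSet {N : ℕ} {s : Finset (Fin N)}
    (hs : IsLowerSet (s : Set (Fin N))) {i : Fin N} : i ∈ s ↔ i.val < s.card := by
  constructor
  · intro hi
    have := Finset.card_le_card fun j hj => hs (Finset.mem_Iic.1 hj) hi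
    rw [Fin.card_Iic] at this
    omega
  · intro hi
    by_contra hn
    have := Finset.card_le_card fun j (hj : j ∈ s) =>
      Finset.mem_Iio.2 (lt_of_not_ge fun hij => hn (hs hij hj))
    rw [Fin.card_Iio] at this
    omega

variable {n : ℕ} {π : Perm (Fin (3 * n))}

theorem isCycleMin_iff_val_lt (h : IsThreeCyclic π) (hπ : Avoids132 π) {i : Fin (3 * n)} :
    IsCycleMin π i ↔ i.val < n := by
  classical
  have hlower : IsLowerSet ((Finset.univ.filter (IsCycleMin π) : Finset _) : Set (Fin (3 * n))) :=
    by simpa using isLowerSet_setOf_isCycleMin h hπ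
  simpa [h.card_isCycleMin (Fintype.card_fin _)] using mem_iff_val_lt_card_of_isLowerSet hlower

theorem IsThreeCyclic.le_val_apply (h : IsThreeCyclic π) (hπ : Avoids132 π) {i : Fin (3 * n)}
    (hi : i.val < n) : n ≤ (π i).val ∧ n ≤ (π (π i)).val := by
  have h₀ := (isCycleMin_iff_val_lt h hπ).2 hi
  rw [← not_lt, ← isCycleMin_iff_val_lt h hπ, h.isCycleMin_apply_iff, ← not_lt,
    ← isCycleMin_iff_val_lt h hπ, h.isCycleMin_apply_apply_iff]
  exact ⟨fun h₁ => h₀.1.not_gt h₁.2, fun h₂ => h₀.2.not_gt h₂.1⟩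

theorem IsThreeCyclic.exists_val_lt (h : IsThreeCyclic π) (hπ : Avoids132 π) (j : Fin (3 * n)) :
    ∃ i : Fin (3 * n), i.val < n ∧ (j = i ∨ j = π i ∨ j = π (π i)) := by
  simpa only [← isCycleMin_iff_val_lt h hπ] using h.exists_isCycleMin j

theorem mem_avStar_iff : π ∈ avStar n pattern132 ↔ IsThreeCyclic π ∧ Avoids132 π :=
  and_congr (cycleType_eq_replicate_three_iff (Fintype.card_fin _)) avoids_pattern132_iff

theorem mem_setA_iff :
    π ∈ setA n ↔ π ∈ avStar n pattern132 ∧ ∀ i, i.val < n → π (π i) < π i := by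
  refine and_congr_right fun hπ => ?_
  rw [mem_avStar_iff] at hπ
  simp only [hπ.1.forall_cycleHasForm_pattern312_iff, isCycleMin_iff_val_lt hπ.1 hπ.2]

end IsCycleMin

section Run

/-- The permutations of `avStar n pattern132` whose first `x` cycles, ordered by their smallest
elements, are of the form `312`, while the next one (if any) is of the form `231`. The smallest
elements are `0, …, n - 1` by `isCycleMin_iff_val_lt`. -/
def run (n x : ℕ) : Set (Perm (Fin (3 * n))) :=
  {π | π ∈ avStar n pattern132 ∧ (∀ i, i.val < x → π (π i) < π i) ∧
    ∀ i, i.val = x → x < n → π i < π (π i)}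

theorem run_self (n : ℕ) : run n n = setA n := by
  ext π
  simp [run, mem_setA_iff]

theorem disjoint_run {n x y : ℕ} (hxy : x < y) (hyn : y ≤ n) : Disjoint (run n x) (run n y) := by
  rw [Set.disjoint_left]
  rintro π ⟨-, -, hx⟩ ⟨-, hy, -⟩
  exact lt_asymm (hx ⟨x, by omega⟩ rfl (by omega)) (hy ⟨x, by omega⟩ hxy)

theorem exists_mem_run {n : ℕ} {π : Perm (Fin (3 * n))} (hπ : π ∈ avStar n pattern132) :
    ∃ x ≤ n, π ∈ run n x := by
  classical
  have hlt (i : Fin (3 * n)) (hi : ¬ π i < π (π i)) : π (π i) < π i :=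
    (not_lt.1 hi).lt_of_ne ((mem_avStar_iff.1 hπ).1.apply_ne _)
  by_cases hex : ∃ x, ∃ hx : x < n, π ⟨x, by omega⟩ < π (π ⟨x, by omega⟩)
  · refine ⟨Nat.find hex, (Nat.find_spec hex).1.le, hπ, fun i hi => hlt i fun hi' => ?_, ?_⟩
    · exact Nat.find_min hex hi ⟨hi.trans (Nat.find_spec hex).1, hi'⟩
    · rintro i hi -
      rw [show i = ⟨Nat.find hex, hi ▸ i.isLt⟩ from Fin.ext hi]
      exact (Nat.find_spec hex).2
  · exact ⟨n, le_rfl, hπ, fun i hi => hlt i fun hi' => hex ⟨i, hi, hi'⟩, by simp⟩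

section CycleOrder

variable {n : ℕ} {π : Perm (Fin (3 * n))}

theorem apply_apply_lt_apply_apply_of_312_of_231 (h : IsThreeCyclic π) (hπ : Avoids132 π)
    {i j : Fin (3 * n)} (hij : i < j) (hj : j.val < n) (hi' : π (π i) < π i)
    (hj' : π j < π (π j)) : π (π j) < π (π i) := by
  have hi₃ := h.apply_apply_apply i
  have hj₃ := h.apply_apply_apply j
  have hni := h.le_val_apply hπ (i := i) (by omega)
  have hnj := h.le_val_apply hπ hj
  by_contra hc
  have hne : π (π i) ≠ π (π j) := (π.injective.comp π.injective).ne hij.ne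
  have hne' : π (π j) ≠ π i := π.injective.ne (by omega)
  have hne'' : π (π i) ≠ π j := π.injective.ne (by omega)
  rcases lt_or_gt_of_ne hne' with hlt | hlt
  · rcases lt_or_gt_of_ne hne'' with hlt' | hlt'
    · exact hπ hlt' hj' (by omega) (by omega)
    · exact hπ (i := j) (j := π j) (k := π i) (by omega) (by omega) (by omega) (by omega)
  · exact hπ hi' hlt (by omega) (by omega)

theorem apply_lt_apply_of_231_of_312 (h : IsThreeCyclic π) (hπ : Avoids132 π)
    {i j : Fin (3 * n)} (hij : i < j) (hj : j.val < n) (hi' : π i < π (π i))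
    (hj' : π (π j) < π j) : π j < π i := by
  have := apply_apply_lt_apply_apply_of_312_of_231 h.inv hπ.inv hij hj
  simp only [h.inv_apply, h.apply_apply_apply] at this
  exact this hi' hj'

theorem not_apply_lt_apply_of_forall_312 (h : IsThreeCyclic π) (hπ : Avoids132 π)
    (h312 : ∀ i, i.val < n → π (π i) < π i) {j k : Fin (3 * n)} (hj : n ≤ j.val) (hjk : j < k)
    (hk : n ≤ (π k).val) : ¬ π k < π j := by
  intro hlt
  obtain ⟨i, hi, hji⟩ := h.exists_val_lt hπ j
  have hi₃ := h.apply_apply_apply i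
  have hi' := h312 i hi
  rcases hji with rfl | rfl | rfl
  · omega
  · exact hπ hi' hjk (by omega) hlt
  · omega

end CycleOrder

variable {x m : ℕ} {π : Perm (Fin (3 * (x + m)))}

theorem lt_apply_apply_of_mem_run (hπ : π ∈ run (x + m) x) {i j : Fin (3 * (x + m))}
    (hi : i.val < x) (hj : x ≤ j.val) (hjn : j.val < x + m) :
    j < π (π i) ∧ π j < π (π i) ∧ π (π j) < π (π i) := by
  obtain ⟨hmem, h312, h231⟩ := hπ
  obtain ⟨h, hav⟩ := mem_avStar_iff.1 hmem
  have hni := h.le_val_apply hav (i := i) (by omega)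
  refine ⟨by omega, ?_⟩
  rcases lt_or_gt_of_ne (h.apply_ne (π j)) with hj' | hj'
  · obtain ⟨k, hk⟩ : ∃ k : Fin (3 * (x + m)), k.val = x := ⟨⟨x, by omega⟩, rfl⟩
    have hk' := h231 k hk (by omega)
    have hkj : k ≠ j := by
      rintro rfl
      exact lt_asymm hj' hk'
    have hik := apply_apply_lt_apply_apply_of_312_of_231 h hav (i := i) (j := k) (by omega)
      (by omega) (h312 i hi) hk'
    have := apply_lt_apply_of_231_of_312 h hav (i := k) (j := j) (by omega) hjn hk' hj'
    omega
  · have := apply_apply_lt_apply_apply_of_312_of_231 h hav (i := i) (by omega) hjn (h312 i hi) hj'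
    omega

theorem isLowerSet_le_apply_of_mem_run (hπ : π ∈ run (x + m) x) :
    IsLowerSet {y | x ≤ (π y).val ∧ x ≤ (π (π y)).val} := by
  obtain ⟨h, hav⟩ := mem_avStar_iff.1 hπ.1
  have hcube := h.apply_apply_apply
  intro y z hzy ⟨hy, hy'⟩
  by_contra hz
  obtain ⟨i, hi, hiz⟩ : ∃ i : Fin (3 * (x + m)), i.val < x ∧ π (π i) ≤ z := by
    by_cases hz' : (π z).val < x
    · exact ⟨π z, hz', by rw [hcube]⟩
    · refine ⟨π (π z), by simp only [Set.mem_ofPred_eq] at hz; omega, ?_⟩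
      have := hπ.2.1 (π (π z)) (by simp only [Set.mem_ofPred_eq] at hz; omega)
      rw [hcube, hcube] at this
      rw [hcube]
      exact this.le
  have hni := h.le_val_apply hav (i := i) (by omega)
  obtain ⟨j, hj, hyj⟩ := h.exists_val_lt hav y
  rcases lt_or_ge j.val x with hjx | hjx
  · rcases hyj with rfl | rfl | rfl
    · omega
    · rw [hcube] at hy'
      omega
    · rw [hcube] at hy
      omega
  · obtain ⟨h₀, h₁, h₂⟩ := lt_apply_apply_of_mem_run hπ hi hjx hj
    rcases hyj with rfl | rfl | rfl <;> omega

theorem card_le_apply (h : IsThreeCyclic π) (hav : Avoids132 π) :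
    (Finset.univ.filter fun y => x ≤ (π y).val ∧ x ≤ (π (π y)).val).card = x + 3 * m := by
  have hcard (σ : Perm (Fin (3 * (x + m)))) :
      (Finset.univ.filter fun y => (σ y).val < x).card = x := by
    rw [Finset.card_equiv σ (t := Finset.univ.filter fun y => y.val < x) (by simp),
      Fin.card_filter_val_lt]
    omega
  have hcard' : (Finset.univ.filter fun y => (π (π y)).val < x).card = x := hcard (π * π)
  have hdisj : Disjoint (Finset.univ.filter fun y => (π y).val < x)
      (Finset.univ.filter fun y => (π (π y)).val < x) := by
    rw [Finset.disjoint_filter]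
    intro y _ hy hy'
    have := (h.le_val_apply hav (i := π y) (by omega)).1
    omega
  have hset : (Finset.univ.filter fun y => x ≤ (π y).val ∧ x ≤ (π (π y)).val) =
      ((Finset.univ.filter fun y => (π y).val < x) ∪
        Finset.univ.filter fun y => (π (π y)).val < x)ᶜ := by
    ext y
    simp
  rw [hset, Finset.card_compl, Finset.card_union_of_disjoint hdisj, hcard, hcard',
    Fintype.card_fin]
  omega

theorem apply_mem_Ico_of_mem_run (hπ : π ∈ run (x + m) x) {y : Fin (3 * (x + m))}
    (hy : y.val ∈ Set.Ico x (x + 3 * m)) : (π y).val ∈ Set.Ico x (x + 3 * m) := by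
  obtain ⟨h, hav⟩ := mem_avStar_iff.1 hπ.1
  have hlt (y : Fin (3 * (x + m))) :
      y.val < x + 3 * m ↔ x ≤ (π y).val ∧ x ≤ (π (π y)).val := by
    have hlower := isLowerSet_le_apply_of_mem_run hπ
    rw [← card_le_apply h hav, ← mem_iff_val_lt_card_of_isLowerSet (by simpa using hlower)]
    simp
  rw [Set.mem_Ico, hlt] at hy ⊢
  rw [h.apply_apply_apply]
  exact ⟨hy.2.1, hy.2.2, hy.1⟩

end Run

section Glue

theorem isThreeCyclic_permCongr_iff {α β : Type*} (e : α ≃ β) {π : Perm α} :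
    IsThreeCyclic (e.permCongr π) ↔ IsThreeCyclic π := by
  constructor
  · refine fun h => ⟨fun i => ?_, fun i => ?_⟩
    · simpa using h.apply_ne (e i)
    · simpa using h.apply_apply_apply (e i)
  · refine fun h => ⟨fun i => ?_, fun i => ?_⟩
    · rw [Equiv.permCongr_apply, ne_eq, ← e.eq_symm_apply]
      exact h.apply_ne _
    · simp [h.apply_apply_apply]

theorem isThreeCyclic_sumCongr_iff {α β : Type*} {π : Perm α} {σ : Perm β} :
    IsThreeCyclic (Equiv.sumCongr π σ) ↔ IsThreeCyclic π ∧ IsThreeCyclic σ := by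
  constructor
  · refine fun h => ⟨⟨fun i => ?_, fun i => ?_⟩, ⟨fun i => ?_, fun i => ?_⟩⟩
    · simpa using h.apply_ne (Sum.inl i)
    · simpa using h.apply_apply_apply (Sum.inl i)
    · simpa using h.apply_ne (Sum.inr i)
    · simpa using h.apply_apply_apply (Sum.inr i)
  · rintro ⟨hπ, hσ⟩
    refine ⟨?_, ?_⟩ <;> rintro (i | i) <;>
      simp [hπ.apply_ne, hσ.apply_ne, hπ.apply_apply_apply, hσ.apply_apply_apply]

/-- The embedding of `Fin (3 * m)` as the interval of length `3 * m` starting at `x`. -/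
def inner (x m : ℕ) : Fin (3 * m) ↪o Fin (3 * (x + m)) :=
  OrderEmbedding.ofStrictMono (fun j => ⟨x + j.val, by omega⟩) fun _ _ hij =>
    Nat.add_lt_add_left hij x

/-- The embedding of `Fin (3 * x)` as the complement of the range of `inner x m`. -/
def outer (x m : ℕ) : Fin (3 * x) ↪o Fin (3 * (x + m)) :=
  OrderEmbedding.ofStrictMono
    (fun i => ⟨if i.val < x then i.val else i.val + 3 * m, by split_ifs <;> omega⟩)
    fun i j hij => by
      simp only [Fin.lt_def] at hij ⊢
      split_ifs <;> omega

theorem val_inner (x m : ℕ) (j : Fin (3 * m)) : (inner x m j).val = x + j.val := rfl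

theorem val_outer (x m : ℕ) (i : Fin (3 * x)) :
    (outer x m i).val = if i.val < x then i.val else i.val + 3 * m := rfl

theorem outer_lt_inner_iff {x m : ℕ} {i : Fin (3 * x)} {j : Fin (3 * m)} :
    outer x m i < inner x m j ↔ i.val < x := by
  rw [Fin.lt_def, val_outer, val_inner]
  split_ifs <;> omega

theorem inner_lt_outer_iff {x m : ℕ} {i : Fin (3 * x)} {j : Fin (3 * m)} :
    inner x m j < outer x m i ↔ x ≤ i.val := by
  rw [Fin.lt_def, val_outer, val_inner]
  split_ifs <;> omega

theorem bijective_elim_inner_outer (x m : ℕ) :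
    Function.Bijective (Sum.elim (inner x m) (outer x m)) := by
  rw [Fintype.bijective_iff_injective_and_card]
  constructor
  · refine (inner x m).injective.sumElim (outer x m).injective fun j i h => ?_
    have := outer_lt_inner_iff.not.1 h.not_gt
    have := inner_lt_outer_iff.not.1 h.not_lt
    omega
  · simp
    omega

/-- The positions of `Fin (3 * (x + m))`, split into the range of `inner x m` and that of
`outer x m`. -/
noncomputable def insertEquiv (x m : ℕ) : Fin (3 * m) ⊕ Fin (3 * x) ≃ Fin (3 * (x + m)) :=
  Equiv.ofBijective _ (bijective_elim_inner_outer x m)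

theorem eq_inner_or_eq_outer {x m : ℕ} (y : Fin (3 * (x + m))) :
    (∃ j, y = inner x m j) ∨ ∃ i, y = outer x m i := by
  obtain ⟨z | z, rfl⟩ := (bijective_elim_inner_outer x m).surjective y
  · exact Or.inl ⟨z, rfl⟩
  · exact Or.inr ⟨z, rfl⟩

/-- The insertion of `τ` into `ρ`, as a block of consecutive positions and values starting
at `x`. -/
noncomputable def glue {x m : ℕ} (τ : Perm (Fin (3 * m))) (ρ : Perm (Fin (3 * x))) :
    Perm (Fin (3 * (x + m))) :=
  (insertEquiv x m).permCongr (Equiv.sumCongr τ ρ)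

variable {x m : ℕ} {τ : Perm (Fin (3 * m))} {ρ : Perm (Fin (3 * x))}

theorem glue_inner (j : Fin (3 * m)) : glue τ ρ (inner x m j) = inner x m (τ j) := by
  have h : (insertEquiv x m).symm (inner x m j) = Sum.inl j :=
    (insertEquiv x m).symm_apply_eq.2 rfl
  rw [glue, Equiv.permCongr_apply, h]
  rfl

theorem glue_outer (i : Fin (3 * x)) : glue τ ρ (outer x m i) = outer x m (ρ i) := by
  have h : (insertEquiv x m).symm (outer x m i) = Sum.inr i :=
    (insertEquiv x m).symm_apply_eq.2 rfl
  rw [glue, Equiv.permCongr_apply, h]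
  rfl

theorem glue_injective (x m : ℕ) : Function.Injective
    fun z : Perm (Fin (3 * m)) × Perm (Fin (3 * x)) => glue z.1 z.2 :=
  (insertEquiv x m).permCongr.injective.comp Perm.sumCongrHom_injective

theorem isThreeCyclic_glue_iff :
    IsThreeCyclic (glue τ ρ) ↔ IsThreeCyclic τ ∧ IsThreeCyclic ρ := by
  rw [glue, isThreeCyclic_permCongr_iff, isThreeCyclic_sumCongr_iff]

theorem Avoids132.of_glue (h : Avoids132 (glue τ ρ)) : Avoids132 τ ∧ Avoids132 ρ :=
  ⟨h.of_strictMono (inner x m).strictMono (inner x m).strictMono glue_inner,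
    h.of_strictMono (outer x m).strictMono (outer x m).strictMono glue_outer⟩

theorem Avoids132.glue (hτ : Avoids132 τ) (h : IsThreeCyclic ρ) (hρ : Avoids132 ρ)
    (h312 : ∀ i, i.val < x → ρ (ρ i) < ρ i) : Avoids132 (glue τ ρ) := by
  have hup (i : Fin (3 * x)) (hi : i.val < x) : x ≤ (ρ i).val := (h.le_val_apply hρ hi).1
  intro i j k hij hjk hik hkj
  rcases eq_inner_or_eq_outer i with ⟨i, rfl⟩ | ⟨i, rfl⟩ <;>
  rcases eq_inner_or_eq_outer j with ⟨j, rfl⟩ | ⟨j, rfl⟩ <;>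
  rcases eq_inner_or_eq_outer k with ⟨k, rfl⟩ | ⟨k, rfl⟩ <;>
  simp only [glue_inner, glue_outer, OrderEmbedding.lt_iff_lt, inner_lt_outer_iff,
    outer_lt_inner_iff] at hij hjk hik hkj
  · exact hτ hij hjk hik hkj
  · omega
  · omega
  · exact not_apply_lt_apply_of_forall_312 h hρ h312 hij hjk hik hkj
  · exact absurd (hup i hij) (by omega)
  · exact absurd (hup i hij) (by omega)
  · exact absurd (hup i (by omega)) (by omega)
  · exact hρ hij hjk hik hkj

theorem exists_glue_eq {π : Perm (Fin (3 * (x + m)))}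
    (hπ : ∀ y : Fin (3 * (x + m)), y.val ∈ Set.Ico x (x + 3 * m) →
      (π y).val ∈ Set.Ico x (x + 3 * m)) :
    ∃ (τ : Perm (Fin (3 * m))) (ρ : Perm (Fin (3 * x))), glue τ ρ = π := by
  obtain ⟨⟨τ, ρ⟩, hτρ⟩ := Perm.mem_sumCongrHom_range_of_perm_mapsTo_inl
    (σ := (insertEquiv x m).symm.permCongr π) <| by
      rintro _ ⟨j, rfl⟩
      obtain ⟨hle, hlt⟩ := hπ (inner x m j) (by rw [val_inner, Set.mem_Ico]; omega)
      refine ⟨⟨(π (inner x m j)).val - x, by omega⟩, ?_⟩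
      rw [Equiv.permCongr_apply, Equiv.symm_symm, Equiv.eq_symm_apply]
      exact Fin.ext (Nat.add_sub_cancel' hle)
  refine ⟨τ, ρ, ?_⟩
  rw [glue, ← Equiv.eq_symm_apply, Equiv.permCongr_symm]
  exact hτρ

theorem glue_mem_run_iff : glue τ ρ ∈ run (x + m) x ↔ τ ∈ run m 0 ∧ ρ ∈ run x x := by
  have hout (i : Fin (3 * x)) (hi : i.val < x) : (outer x m i).val = i.val := if_pos hi
  have h312 : (∀ y, y.val < x → glue τ ρ (glue τ ρ y) < glue τ ρ y) ↔
      ∀ i, i.val < x → ρ (ρ i) < ρ i := by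
    constructor
    · intro h i hi
      simpa [glue_outer] using h (outer x m i) (by rwa [hout i hi])
    · intro h y hy
      rcases eq_inner_or_eq_outer y with ⟨j, rfl⟩ | ⟨i, rfl⟩
      · rw [val_inner] at hy
        omega
      · simpa [glue_outer] using h i (by rw [val_outer] at hy; split_ifs at hy <;> omega)
  have h231 : (∀ y, y.val = x → x < x + m → glue τ ρ y < glue τ ρ (glue τ ρ y)) ↔
      ∀ j, j.val = 0 → 0 < m → τ j < τ (τ j) := by
    constructor
    · intro h j hj hm
      simpa [glue_inner] using h (inner x m j) (by rw [val_inner, hj, add_zero])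
        (Nat.lt_add_of_pos_right hm)
    · intro h y hy hm
      rcases eq_inner_or_eq_outer y with ⟨j, rfl⟩ | ⟨i, rfl⟩
      · rw [val_inner] at hy
        simpa [glue_inner] using h j (by omega) (by omega)
      · rw [val_outer] at hy
        split_ifs at hy <;> omega
  simp only [run, Set.mem_ofPred_eq, mem_avStar_iff, h312, h231, isThreeCyclic_glue_iff]
  constructor
  · rintro ⟨⟨⟨hτ, hρ⟩, hav⟩, h₁, h₂⟩
    exact ⟨⟨⟨hτ, hav.of_glue.1⟩, by simp, h₂⟩, ⟨hρ, hav.of_glue.2⟩, h₁, by simp⟩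
  · rintro ⟨⟨⟨hτ, hτ'⟩, -, h₂⟩, ⟨hρ, hρ'⟩, h₁, -⟩
    exact ⟨⟨⟨hτ, hρ⟩, hτ'.glue hρ hρ' h₁⟩, h₁, h₂⟩

theorem run_add_eq_image (x m : ℕ) : run (x + m) x =
    (fun z : Perm (Fin (3 * m)) × Perm (Fin (3 * x)) => glue z.1 z.2) '' (run m 0 ×ˢ run x x) := by
  ext π
  constructor
  · intro hπ
    obtain ⟨τ, ρ, rfl⟩ := exists_glue_eq fun y => apply_mem_Ico_of_mem_run hπ (y := y)
    exact ⟨(τ, ρ), glue_mem_run_iff.1 hπ, rfl⟩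
  · rintro ⟨z, hz, rfl⟩
    exact glue_mem_run_iff.2 hz

theorem ncard_run_add (x m : ℕ) : (run (x + m) x).ncard = (setA x).ncard * (run m 0).ncard := by
  rw [run_add_eq_image, Set.ncard_image_of_injective _ (glue_injective x m), Set.ncard_prod,
    run_self, mul_comm]

end Glue

section Count

theorem ncard_avStar_eq_sum (n : ℕ) : (avStar n pattern132).ncard =
    ∑ x ∈ Finset.range (n + 1), (setA x).ncard * (run (n - x) 0).ncard := by
  have hunion : avStar n pattern132 = ⋃ x ∈ (Finset.range (n + 1) : Set ℕ), run n x := by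
    ext π
    simp only [Set.mem_iUnion, exists_prop, Finset.coe_range, Set.mem_Iio, Nat.lt_succ_iff]
    exact ⟨exists_mem_run, fun ⟨_, _, hπ⟩ => hπ.1⟩
  have hdisj : (Finset.range (n + 1) : Set ℕ).PairwiseDisjoint (run n) := by
    intro x hx y hy hxy
    simp only [Finset.coe_range, Set.mem_Iio, Nat.lt_succ_iff] at hx hy
    rcases hxy.lt_or_gt with hlt | hlt
    · exact disjoint_run hlt hy
    · exact (disjoint_run hlt hx).symm
  rw [hunion, (Finset.finite_toSet _).ncard_biUnion (fun _ _ => Set.toFinite _) hdisj,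
    finsum_mem_coe_finset]
  refine Finset.sum_congr rfl fun x hx => ?_
  obtain ⟨m, rfl⟩ := Nat.exists_eq_add_of_le (Finset.mem_range_succ_iff.1 hx)
  rw [ncard_run_add, Nat.add_sub_cancel_left]

theorem inv_mem_avStar {n : ℕ} {π : Perm (Fin (3 * n))} (hπ : π ∈ avStar n pattern132) :
    π⁻¹ ∈ avStar n pattern132 :=
  mem_avStar_iff.2 ⟨(mem_avStar_iff.1 hπ).1.inv, (mem_avStar_iff.1 hπ).2.inv⟩

-- Inversion exchanges the forms `312` and `231`, in particular that of the first cycle.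
theorem image_inv_run_zero {n : ℕ} (hn : n ≠ 0) :
    Inv.inv '' run n 0 = avStar n pattern132 \ run n 0 := by
  have hrun (π : Perm (Fin (3 * n))) : π ∈ run n 0 ↔ π ∈ avStar n pattern132 ∧
      π ⟨0, by omega⟩ < π (π ⟨0, by omega⟩) := by
    refine and_congr_right fun _ => ⟨fun h => h.2 _ rfl (by omega), fun h => ⟨by simp, ?_⟩⟩
    rintro ⟨i, hi⟩ rfl -
    exact h
  ext π
  rw [Set.image_inv_eq_inv, Set.mem_inv, Set.mem_sdiff, hrun, hrun]
  constructor
  · rintro ⟨hπ, hlt⟩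
    have hπ' := inv_mem_avStar hπ
    rw [inv_inv] at hπ'
    have h' := (mem_avStar_iff.1 hπ').1
    simp only [h'.inv_apply, h'.apply_apply_apply] at hlt
    exact ⟨hπ', fun hlt' => lt_asymm hlt hlt'.2⟩
  · rintro ⟨hπ, hlt⟩
    have h := (mem_avStar_iff.1 hπ).1
    refine ⟨inv_mem_avStar hπ, ?_⟩
    simp only [h.inv_apply, h.apply_apply_apply]
    exact (not_lt.1 fun hlt' => hlt ⟨hπ, hlt'⟩).lt_of_ne (h.apply_ne _)

theorem ncard_avStar {n : ℕ} (hn : n ≠ 0) :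
    (avStar n pattern132).ncard = 2 * (run n 0).ncard := by
  have hsub : run n 0 ⊆ avStar n pattern132 := fun _ hπ => hπ.1
  have hdiff := Set.ncard_sdiff_add_ncard_of_subset hsub
  rw [← image_inv_run_zero hn, Set.ncard_image_of_injective _ inv_injective] at hdiff
  omega

theorem ncard_run_zero_zero : (run 0 0).ncard = 1 := by
  have : run 0 0 = Set.univ := Set.eq_univ_of_forall fun π =>
    ⟨mem_avStar_iff.2 ⟨⟨finZeroElim, finZeroElim⟩, fun i => i.elim0⟩, by simp, by simp⟩
  rw [this, Set.ncard_univ, Nat.card_eq_fintype_card, Fintype.card_perm]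
  rfl

theorem ncard_setA_zero : (setA 0).ncard = 1 := by
  rw [← run_self, ncard_run_zero_zero]

theorem ncard_run_zero_succ (n : ℕ) : (run (n + 1) 0).ncard =
    ∑ x ∈ Finset.range (n + 1), (setA (x + 1)).ncard * (run (n - x) 0).ncard := by
  have hsub (x : ℕ) : (run (n + 1 - (x + 1)) 0).ncard = (run (n - x) 0).ncard := by
    rw [Nat.add_sub_add_right]
  have hsum := ncard_avStar_eq_sum (n + 1)
  rw [ncard_avStar (by omega), Finset.sum_range_succ', ncard_setA_zero, Nat.sub_zero, one_mul]
    at hsum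
  simp only [hsub] at hsum
  omega

end Count

section Composition

variable {R : Type*} [CommSemiring R]

/-- The composition of `n + 1` with first block `x + 1`, followed by a composition of `n - x`. -/
def consBlock (n : ℕ) (z : Σ x : Fin (n + 1), Composition (n - x)) : Composition (n + 1) where
  blocks := (z.1.val + 1) :: z.2.blocks
  blocks_pos := by
    intro i hi
    rcases List.mem_cons.1 hi with rfl | hi
    · omega
    · exact z.2.blocks_pos hi
  blocks_sum := by
    rw [List.sum_cons, z.2.blocks_sum]
    omega

theorem consBlock_bijective (n : ℕ) : Function.Bijective (consBlock n) := by
  constructor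
  · rintro ⟨x, c⟩ ⟨y, d⟩ h
    obtain ⟨hxy : x.val + 1 = y.val + 1, hcd : c.blocks = d.blocks⟩ :=
      List.cons.inj (congrArg Composition.blocks h)
    obtain rfl : x = y := by omega
    rw [Composition.ext hcd]
  · intro c
    rcases hb : c.blocks with _ | ⟨b, l⟩
    · exact absurd (c.blocks_eq_nil.1 hb) n.succ_ne_zero
    · have hsum : b + l.sum = n + 1 := by rw [← List.sum_cons, ← hb, c.blocks_sum]
      have hpos : 0 < b := c.blocks_pos (by simp [hb])
      refine ⟨⟨⟨b - 1, by omega⟩, ⟨l, fun {i} hi => c.blocks_pos (by simp [hb, hi]), ?_⟩⟩, ?_⟩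
      · dsimp only
        omega
      · refine Composition.ext ?_
        simp only [consBlock]
        rw [hb, Nat.sub_add_cancel hpos]

theorem prod_blocksFun {n : ℕ} (f : ℕ → R) (c : Composition n) :
    ∏ i, f (c.blocksFun i) = (c.blocks.map f).prod := by
  rw [← List.prod_ofFn, ← c.ofFn_blocksFun, List.map_ofFn]
  rfl

theorem sum_composition_zero (f : ℕ → R) :
    ∑ c : Composition 0, ∏ i, f (c.blocksFun i) = 1 := by
  simp [prod_blocksFun, fun c : Composition 0 => c.blocks_eq_nil.2 rfl, composition_card]

theorem sum_composition_succ (f : ℕ → R) (n : ℕ) :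
    ∑ c : Composition (n + 1), ∏ i, f (c.blocksFun i) =
      ∑ x ∈ Finset.range (n + 1),
        f (x + 1) * ∑ c : Composition (n - x), ∏ i, f (c.blocksFun i) := by
  simp only [prod_blocksFun]
  rw [← (consBlock_bijective n).sum_comp, Fintype.sum_sigma,
    Finset.sum_range fun x => f (x + 1) * ∑ c : Composition (n - x), (c.blocks.map f).prod]
  simp only [consBlock, List.map_cons, List.prod_cons, Finset.mul_sum]

theorem ncard_run_zero_eq_sum (n : ℕ) : (run n 0).ncard =
    ∑ c : Composition n, ∏ i, (setA (c.blocksFun i)).ncard := by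
  induction n using Nat.strong_induction_on with
  | _ n ih =>
    rcases n with _ | n
    · rw [ncard_run_zero_zero, sum_composition_zero fun x => (setA x).ncard]
    · rw [ncard_run_zero_succ, sum_composition_succ fun x => (setA x).ncard]
      refine Finset.sum_congr rfl fun x _ => ?_
      rw [ih _ (by omega)]

end Composition

section AvJoined

/-- The `132`-avoiding permutations all of whose non-inversions span only positions where `E`
holds; the non-inversion `k < l` spans the half-open interval `[k, l)`. -/
def avJoined (n : ℕ) (E : ℕ → Prop) : Set (Perm (Fin n)) :=
  {τ | Avoids132 τ ∧ ∀ k l, k < l → τ k < τ l → ∀ j : ℕ, k.val ≤ j → j < l.val → E j}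

/-- The positions of a permutation of `Fin (i + s + 1)`, split into those to the left of `i`,
those to the right of `i`, and `i` itself. -/
noncomputable def splitPos (i s : ℕ) : Fin i ⊕ (Fin s ⊕ Unit) ≃ Fin (i + s + 1) :=
  Equiv.ofBijective
    (fun
      | Sum.inl k => ⟨k.val, by omega⟩
      | Sum.inr (Sum.inl k) => ⟨i + 1 + k.val, by omega⟩
      | Sum.inr (Sum.inr _) => ⟨i, by omega⟩) <| by
    rw [Fintype.bijective_iff_injective_and_card]
    constructor
    · rintro (a | a | a) (b | b | b) hab <;> simp only [Fin.mk.injEq] at hab <;>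
        first | (exfalso; omega) | (congr <;> omega)
    · simp
      omega

/-- The values of a `132`-avoiding permutation of `Fin (i + s + 1)` with maximum at position `i`,
split into those to the left of the maximum, those to the right of it, and the maximum itself. -/
noncomputable def splitVal (i s : ℕ) : Fin i ⊕ (Fin s ⊕ Unit) ≃ Fin (i + s + 1) :=
  Equiv.ofBijective
    (fun
      | Sum.inl k => ⟨s + k.val, by omega⟩
      | Sum.inr (Sum.inl k) => ⟨k.val, by omega⟩
      | Sum.inr (Sum.inr _) => ⟨i + s, by omega⟩) <| by
    rw [Fintype.bijective_iff_injective_and_card]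
    constructor
    · rintro (a | a | a) (b | b | b) hab <;> simp only [Fin.mk.injEq] at hab <;>
        first | (exfalso; omega) | (congr <;> omega)
    · simp
      omega

/-- The permutation `L max R`, with the letters of `L` above those of `R`. -/
noncomputable def joinMax {i s : ℕ} (L : Perm (Fin i)) (R : Perm (Fin s)) :
    Perm (Fin (i + s + 1)) :=
  (splitPos i s).equivCongr (splitVal i s) (Equiv.sumCongr L (Equiv.sumCongr R (Equiv.refl Unit)))

variable {i s : ℕ} {L : Perm (Fin i)} {R : Perm (Fin s)}

theorem joinMax_splitPos (z : Fin i ⊕ (Fin s ⊕ Unit)) : joinMax L R (splitPos i s z) =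
    splitVal i s (Sum.map L (Sum.map R id) z) := by
  rw [joinMax, Equiv.equivCongr_apply_apply, Equiv.symm_apply_apply]
  rfl

theorem joinMax_injective (i s : ℕ) : Function.Injective
    fun z : Perm (Fin i) × Perm (Fin s) => joinMax z.1 z.2 := by
  rintro ⟨L, R⟩ ⟨L', R'⟩ h
  have h₁ := Perm.sumCongrHom_injective (a₁ := (L, Equiv.sumCongr R (Equiv.refl Unit)))
    (a₂ := (L', Equiv.sumCongr R' (Equiv.refl Unit))) (((splitPos i s).equivCongr _).injective h)
  have h₂ := Perm.sumCongrHom_injective (a₁ := (R, Equiv.refl Unit)) (a₂ := (R', Equiv.refl Unit))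
    (congrArg Prod.snd h₁)
  exact Prod.ext (congrArg Prod.fst h₁ :) (congrArg Prod.fst h₂ :)

theorem Avoids132.isLowerSet_setOf_lt_val_symm_apply {τ : Perm (Fin (i + s + 1))}
    (h : Avoids132 τ) (hi : (τ ⟨i, by omega⟩).val = i + s) :
    IsLowerSet {y | i < (τ.symm y).val} := by
  have hmax (k : Fin (i + s + 1)) : τ k ≤ τ ⟨i, by omega⟩ := by omega
  intro y z hzy hy
  by_contra hz
  rw [Set.mem_ofPred_eq] at hy hz
  have hlt : z < y := hzy.lt_of_ne fun e => hz (e ▸ hy)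
  rcases (not_lt.1 hz).lt_or_eq with hz | hz
  · have hne : τ (τ.symm y) ≠ τ ⟨i, by omega⟩ := fun e =>
      hy.ne' (congrArg Fin.val (τ.injective e))
    exact h (i := τ.symm z) (j := ⟨i, by omega⟩) (k := τ.symm y) hz hy (by simpa using hlt)
      ((hmax _).lt_of_ne hne)
  · have hzi : τ.symm z = ⟨i, by omega⟩ := Fin.ext hz
    have hle := hmax (τ.symm y)
    rw [← hzi, τ.apply_symm_apply, τ.apply_symm_apply] at hle
    exact hle.not_gt hlt

theorem Avoids132.lt_val_iff_val_apply_lt {τ : Perm (Fin (i + s + 1))} (h : Avoids132 τ)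
    (hi : (τ ⟨i, by omega⟩).val = i + s) {k : Fin (i + s + 1)} :
    i < k.val ↔ (τ k).val < s := by
  have hlower := h.isLowerSet_setOf_lt_val_symm_apply hi
  have hcard : (Finset.univ.filter fun y => i < (τ.symm y).val).card = s := by
    rw [Finset.card_equiv τ.symm (t := Finset.Ioi ⟨i, by omega⟩) (by simp [Fin.lt_def]),
      Fin.card_Ioi]
    dsimp only
    omega
  rw [← Finset.coe_filter_univ] at hlower
  simpa [hcard] using mem_iff_val_lt_card_of_isLowerSet hlower (i := τ k)

theorem exists_joinMax_eq {τ : Perm (Fin (i + s + 1))} (h : Avoids132 τ)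
    (hi : (τ ⟨i, by omega⟩).val = i + s) : ∃ L R, joinMax L R = τ := by
  have hL (k : Fin i) : ∃ l, splitVal i s (Sum.inl l) = τ (splitPos i s (Sum.inl k)) := by
    have hs := (h.lt_val_iff_val_apply_lt hi (k := splitPos i s (Sum.inl k))).not.1 (by
      simp [splitPos])
    have hne : τ (splitPos i s (Sum.inl k)) ≠ τ ⟨i, by omega⟩ := fun e =>
      k.isLt.ne (congrArg Fin.val (τ.injective e))
    refine ⟨⟨(τ (splitPos i s (Sum.inl k))).val - s, by omega⟩, Fin.ext ?_⟩
    simp only [splitVal, Equiv.ofBijective_apply]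
    omega
  have hR (k : Fin s) : ∃ r, splitVal i s (Sum.inr (Sum.inl r)) =
      τ (splitPos i s (Sum.inr (Sum.inl k))) :=
    ⟨⟨_, (h.lt_val_iff_val_apply_lt hi).1 (by simp [splitPos]; omega)⟩, rfl⟩
  obtain ⟨σ, rfl⟩ := ((splitPos i s).equivCongr (splitVal i s)).surjective τ
  simp only [Equiv.equivCongr_apply_apply, Equiv.symm_apply_apply, EmbeddingLike.apply_eq_iff_eq]
    at hL hR
  obtain ⟨⟨L, σ'⟩, rfl⟩ := Perm.mem_sumCongrHom_range_of_perm_mapsTo_inl (σ := σ) <| by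
    rintro _ ⟨k, rfl⟩
    exact hL k
  obtain ⟨⟨R, u⟩, rfl⟩ := Perm.mem_sumCongrHom_range_of_perm_mapsTo_inl (σ := σ') <| by
    rintro _ ⟨k, rfl⟩
    exact (hR k).imp fun _ hr => Sum.inr_injective hr
  exact ⟨L, R, by rw [joinMax, Subsingleton.elim (Equiv.refl Unit) u]; rfl⟩

theorem avoids132_joinMax_iff : Avoids132 (joinMax L R) ↔ Avoids132 L ∧ Avoids132 R := by
  constructor
  · refine fun h => ⟨h.of_strictMono (g := fun k => splitPos i s (Sum.inl k))
      (h := fun k => splitVal i s (Sum.inl k)) ?_ ?_ fun k => joinMax_splitPos _,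
      h.of_strictMono (g := fun k => splitPos i s (Sum.inr (Sum.inl k)))
      (h := fun k => splitVal i s (Sum.inr (Sum.inl k))) ?_ ?_ fun k => joinMax_splitPos _⟩
    all_goals
      intro k l hkl
      simp only [splitPos, splitVal, Equiv.ofBijective_apply, Fin.lt_def]
      omega
  · rintro ⟨hL, hR⟩ a b c hab hbc hac hcb
    obtain ⟨a, rfl⟩ := (splitPos i s).surjective a
    obtain ⟨b, rfl⟩ := (splitPos i s).surjective b
    obtain ⟨c, rfl⟩ := (splitPos i s).surjective c
    rw [joinMax_splitPos, joinMax_splitPos, Fin.lt_def] at hac hcb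
    rcases a with a | a | a <;> rcases b with b | b | b <;> rcases c with c | c | c <;>
      simp only [splitPos, splitVal, Sum.map_inl, Sum.map_inr, Equiv.ofBijective_apply, Fin.lt_def]
        at hab hbc hac hcb <;> try omega
    · exact hL (i := a) (j := b) (k := c) (by omega) (by omega) (by omega) (by omega)
    · exact hR (i := a) (j := b) (k := c) (by omega) (by omega) (by omega) (by omega)

theorem joinMax_mem_avJoined_iff {E : ℕ → Prop} : joinMax L R ∈ avJoined (i + s + 1) E ↔
    (∀ j < i, E j) ∧ Avoids132 L ∧ R ∈ avJoined s fun j => E (j + (i + 1)) := by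
  simp only [avJoined, Set.mem_ofPred_eq, avoids132_joinMax_iff]
  constructor
  · rintro ⟨⟨hL, hR⟩, h⟩
    refine ⟨fun j hj => ?_, hL, hR, fun k l hkl hRkl j hkj hjl => ?_⟩
    · refine h (splitPos i s (Sum.inl ⟨0, by omega⟩)) (splitPos i s (Sum.inr (Sum.inr ()))) ?_ ?_
        j (by simp [splitPos]) (by simpa [splitPos] using hj)
      · simp only [splitPos, Equiv.ofBijective_apply, Fin.lt_def]
        omega
      · simp only [joinMax_splitPos, splitVal, Sum.map_inl, Sum.map_inr, Equiv.ofBijective_apply,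
          Fin.lt_def]
        omega
    · refine h (splitPos i s (Sum.inr (Sum.inl k))) (splitPos i s (Sum.inr (Sum.inl l))) ?_ ?_ _
        ?_ ?_
      · exact Nat.add_lt_add_left hkl (i + 1)
      · rwa [joinMax_splitPos, joinMax_splitPos]
      all_goals
        simp only [splitPos, Equiv.ofBijective_apply]
        omega
  · rintro ⟨hE, hL, hR, h⟩
    refine ⟨⟨hL, hR⟩, fun a b hab hlt j haj hjb => ?_⟩
    obtain ⟨a, rfl⟩ := (splitPos i s).surjective a
    obtain ⟨b, rfl⟩ := (splitPos i s).surjective b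
    rw [joinMax_splitPos, joinMax_splitPos, Fin.lt_def] at hlt
    rcases lt_or_ge j i with hj | hj
    · exact hE j hj
    · rcases a with a | a | a <;> rcases b with b | b | b <;>
        simp only [splitPos, splitVal, Sum.map_inl, Sum.map_inr, Equiv.ofBijective_apply,
          Fin.lt_def] at hab hlt haj hjb <;> try omega
      have := h a b (by omega) (by omega) (j - (i + 1)) (by omega) (by omega)
      rwa [Nat.sub_add_cancel (by omega)] at this

end AvJoined

section CountAvJoined

theorem ncard_avJoined_zero (E : ℕ → Prop) : (avJoined 0 E).ncard = 1 := by
  have : avJoined 0 E = Set.univ :=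
    Set.eq_univ_of_forall fun _ => ⟨fun i => i.elim0, fun i => i.elim0⟩
  rw [this, Set.ncard_univ, Nat.card_eq_fintype_card, Fintype.card_perm]
  rfl

open Classical in
theorem ncard_setOf_mem_avJoined_and_apply_eq_last (i s : ℕ) (E : ℕ → Prop) :
    {τ ∈ avJoined (i + s + 1) E | (τ ⟨i, by omega⟩).val = i + s}.ncard =
      if ∀ j < i, E j then (avJoined i fun _ => True).ncard *
        (avJoined s fun j => E (j + (i + 1))).ncard else 0 := by
  have himage : {τ ∈ avJoined (i + s + 1) E | (τ ⟨i, by omega⟩).val = i + s} =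
      (fun z : Perm (Fin i) × Perm (Fin s) => joinMax z.1 z.2) ''
        {z | (∀ j < i, E j) ∧ z ∈ (avJoined i fun _ => True) ×ˢ
          (avJoined s fun j => E (j + (i + 1)))} := by
    ext τ
    constructor
    · rintro ⟨hτ, hi⟩
      obtain ⟨L, R, rfl⟩ := exists_joinMax_eq hτ.1 hi
      obtain ⟨hE, hL, hR⟩ := joinMax_mem_avJoined_iff.1 hτ
      exact ⟨(L, R), ⟨hE, ⟨hL, by simp⟩, hR⟩, rfl⟩
    · rintro ⟨⟨L, R⟩, ⟨hE, hL, hR⟩, rfl⟩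
      exact ⟨joinMax_mem_avJoined_iff.2 ⟨hE, hL.1, hR⟩,
        congrArg Fin.val (joinMax_splitPos (Sum.inr (Sum.inr ())))⟩
  rw [himage, Set.ncard_image_of_injective _ (joinMax_injective i s)]
  split_ifs with hE
  · rw [← Set.ncard_prod]
    congr 1
    ext z
    exact and_iff_right hE
  · simp [hE]

open Classical in
theorem ncard_avJoined_succ (m : ℕ) (E : ℕ → Prop) :
    (avJoined (m + 1) E).ncard = ∑ i ∈ Finset.range (m + 1),
      if ∀ j < i, E j then (avJoined i fun _ => True).ncard *
        (avJoined (m - i) fun j => E (j + (i + 1))).ncard else 0 := by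
  have hfiber : (avJoined (m + 1) E).ncard = ∑ i : Fin (m + 1),
      {τ ∈ avJoined (m + 1) E | (τ i).val = m}.ncard := by
    rw [Set.ncard_eq_toFinset_card', Finset.card_eq_sum_card_fiberwise
      (f := fun τ : Perm (Fin (m + 1)) => τ⁻¹ (Fin.last m)) (t := Finset.univ) (by simp)]
    refine Finset.sum_congr rfl fun i _ => ?_
    rw [Set.ncard_eq_toFinset_card']
    congr 1
    ext τ
    simp only [Finset.mem_filter, Set.mem_toFinset, Set.mem_ofPred_eq, Perm.inv_eq_iff_eq]
    rw [Fin.ext_iff, eq_comm, Fin.val_last]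
  rw [hfiber, Finset.sum_range]
  refine Finset.sum_congr rfl fun ⟨i, hi⟩ _ => ?_
  obtain ⟨s, rfl⟩ := Nat.exists_eq_add_of_le (Nat.lt_succ_iff.1 hi)
  rw [Nat.add_sub_cancel_left]
  exact ncard_setOf_mem_avJoined_and_apply_eq_last i s E

theorem ncard_avJoined_true (n : ℕ) : (avJoined n fun _ => True).ncard = catalan n := by
  induction n using Nat.strong_induction_on with
  | _ n ih =>
    rcases n with _ | n
    · rw [ncard_avJoined_zero, catalan_zero]
    · rw [ncard_avJoined_succ, catalan_succ, Finset.sum_range]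
      refine Finset.sum_congr rfl fun i _ => ?_
      rw [if_pos (by simp), ih _ (by omega), ih _ (by omega)]

theorem avJoined_congr {n : ℕ} {E E' : ℕ → Prop} (h : ∀ j, j + 1 < n → (E j ↔ E' j)) :
    avJoined n E = avJoined n E' := by
  ext τ
  refine and_congr_right fun _ => forall₄_congr fun k l _ _ => forall₃_congr fun j _ hj => h j ?_
  omega

end CountAvJoined

section Paths

variable {L : Type*} [Fintype L]

open Classical in
/-- The words in the alphabet `L`, with steps `wt`, that lead from height `h` to height `0` and
never go below height `0`. -/
noncomputable def paths (wt : L → ℤ) (h : ℤ) (n : ℕ) : Finset (Fin n → L) :=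
  Finset.univ.filter fun s =>
    (∀ k : ℕ, 0 ≤ h + ∑ i : Fin n with i.val < k, wt (s i)) ∧ h + ∑ i, wt (s i) = 0

variable {wt : L → ℤ} {h : ℤ} {n : ℕ}

theorem mem_paths {s : Fin n → L} : s ∈ paths wt h n ↔
    (∀ k : ℕ, 0 ≤ h + ∑ i : Fin n with i.val < k, wt (s i)) ∧ h + ∑ i, wt (s i) = 0 := by
  simp only [paths, Finset.mem_filter_univ]

theorem paths_eq_empty (hh : h < 0) (n : ℕ) : paths wt h n = ∅ := by
  refine Finset.eq_empty_of_forall_notMem fun s hs => hh.not_ge ?_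
  simpa using (mem_paths.1 hs).1 0

theorem cons_mem_paths_iff {l : L} {s : Fin n → L} :
    (Fin.cons l s : Fin (n + 1) → L) ∈ paths wt h (n + 1) ↔
      0 ≤ h ∧ s ∈ paths wt (h + wt l) n := by
  have hsum (k : ℕ) :
      ∑ i : Fin (n + 1) with i.val < k + 1, wt ((Fin.cons l s : Fin (n + 1) → L) i) =
        wt l + ∑ i : Fin n with i.val < k, wt (s i) := by
    simp [Finset.sum_filter, Fin.sum_univ_succ]
  rw [mem_paths, mem_paths, Fin.sum_univ_succ, Nat.and_forall_add_one.symm]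
  simp only [Fin.cons_zero, Fin.cons_succ, hsum, ← add_assoc, and_assoc]
  simp

theorem sum_paths_succ {M : Type*} [AddCommMonoid M] (hh : 0 ≤ h) (g : (Fin (n + 1) → L) → M) :
    ∑ s ∈ paths wt h (n + 1), g s = ∑ l, ∑ s ∈ paths wt (h + wt l) n, g (Fin.cons l s) := by
  classical
  have hite {m : ℕ} {k : ℤ} (f : (Fin m → L) → M) : ∑ s ∈ paths wt k m, f s =
      ∑ s, if s ∈ paths wt k m then f s else 0 := by
    rw [Finset.sum_ite_mem, Finset.univ_inter]
  rw [hite, ← (Fin.consEquiv fun _ : Fin (n + 1) => L).sum_comp, Fintype.sum_prod_type]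
  refine Finset.sum_congr rfl fun l _ => ?_
  rw [hite]
  exact Finset.sum_congr rfl fun s _ =>
    if_congr (cons_mem_paths_iff.trans (and_iff_right hh)) rfl rfl

theorem sum_paths_zero {M : Type*} [AddCommMonoid M] (h : ℤ) (g : (Fin 0 → L) → M) :
    ∑ s ∈ paths wt h 0, g s = if h = 0 then g Fin.elim0 else 0 := by
  have hmem (s : Fin 0 → L) : s ∈ paths wt h 0 ↔ h = 0 := by
    simp +contextual [mem_paths]
  split_ifs with h0
  · rw [Finset.eq_univ_of_forall fun s => (hmem s).2 h0, Fintype.sum_unique]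
    rfl
  · rw [Finset.eq_empty_of_forall_notMem fun s hs => h0 ((hmem s).1 hs), Finset.sum_empty]

end Paths

section PathPerms

/-- The weight of a pair of bits. -/
def bitWeight (l : Bool × Bool) : ℤ := (if l.2 then 1 else 0) - (if l.1 then 1 else 0)

/-- The positions of a word where the letter is `(false, false)`. -/
def flatAt {n : ℕ} (w : Fin n → Bool × Bool) (j : ℕ) : Prop :=
  ∃ hj : j < n, w ⟨j, hj⟩ = (false, false)

theorem flatAt_cons_succ {n : ℕ} {l : Bool × Bool} {w : Fin n → Bool × Bool} {j : ℕ} :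
    flatAt (Fin.cons l w : Fin (n + 1) → Bool × Bool) (j + 1) ↔ flatAt w j :=
  ⟨fun ⟨_, h⟩ => ⟨by omega, h⟩, fun ⟨_, h⟩ => ⟨by omega, h⟩⟩

theorem flatAt_cons_zero {n : ℕ} {l : Bool × Bool} {w : Fin n → Bool × Bool} :
    flatAt (Fin.cons l w : Fin (n + 1) → Bool × Bool) 0 ↔ l = (false, false) :=
  ⟨fun ⟨_, h⟩ => h, fun h => ⟨n.succ_pos, h⟩⟩

/-- The number of pairs of a path from height `h` and a permutation of one more letter all of whose
non-inversions span only flat letters of the path. -/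
noncomputable def pathPerms (h : ℤ) (n : ℕ) : ℕ :=
  ∑ w ∈ paths bitWeight h n, (avJoined (n + 1) (flatAt w)).ncard

open Classical in
/-- The number of pairs counted by `pathPerms` in which the maximum of the permutation is at
position `i`, without the choice of the permutation of the letters to the left of the maximum. -/
noncomputable def pathPermsTail (i : ℕ) (h : ℤ) (n : ℕ) : ℕ :=
  ∑ w ∈ paths bitWeight h n, if ∀ j < i, flatAt w j then
    (avJoined (n - i) fun j => flatAt w (j + (i + 1))).ncard else 0

theorem pathPermsTail_succ (i : ℕ) (h : ℤ) (n : ℕ) :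
    pathPermsTail (i + 1) h (n + 1) = pathPermsTail i h n := by
  classical
  rcases lt_or_ge h 0 with hh | hh
  · simp [pathPermsTail, paths_eq_empty hh]
  have hflat : h + bitWeight (false, false) = h := by simp [bitWeight]
  unfold pathPermsTail
  rw [sum_paths_succ hh, Fintype.sum_eq_single (false, false), hflat]
  · refine Finset.sum_congr rfl fun w _ => ?_
    rw [Nat.add_sub_add_right]
    refine if_congr ?_ ?_ rfl
    · simp only [Nat.forall_lt_succ_left, flatAt_cons_zero, flatAt_cons_succ, true_and]
    · simp only [← Nat.add_assoc, flatAt_cons_succ]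
  · intro l hl
    exact Finset.sum_eq_zero fun w _ => if_neg fun hj =>
      hl (flatAt_cons_zero.1 (hj 0 i.succ_pos))

theorem pathPermsTail_add (i : ℕ) (h : ℤ) (n : ℕ) :
    pathPermsTail i h (n + i) = pathPermsTail 0 h n := by
  induction i with
  | zero => rfl
  | succ i ih => rw [← add_assoc, pathPermsTail_succ, ih]

theorem pathPerms_eq_sum (h : ℤ) (n : ℕ) : pathPerms h n =
    ∑ i ∈ Finset.range (n + 1), catalan i * pathPermsTail 0 h (n - i) := by
  classical
  simp only [pathPerms, ncard_avJoined_succ, ncard_avJoined_true]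
  rw [Finset.sum_comm]
  refine Finset.sum_congr rfl fun i hi => ?_
  rw [← pathPermsTail_add i, Nat.sub_add_cancel (Finset.mem_range_succ_iff.1 hi), pathPermsTail,
    Finset.mul_sum]
  simp only [mul_ite, mul_zero]

theorem pathPermsTail_zero_zero (h : ℤ) : pathPermsTail 0 h 0 = if h = 0 then 1 else 0 := by
  rw [pathPermsTail, sum_paths_zero]
  simp [ncard_avJoined_zero]

theorem sum_bool_prod_bitWeight {M : Type*} [AddCommMonoid M] (f : ℤ → M) :
    ∑ l, f (bitWeight l) = f (-1) + (f 0 + f 0) + f 1 := by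
  simp [Fintype.sum_prod_type, bitWeight]
  abel

theorem pathPermsTail_zero_succ {h : ℤ} (hh : 0 ≤ h) (n : ℕ) : pathPermsTail 0 h (n + 1) =
    pathPerms (h - 1) n + 2 * pathPerms h n + pathPerms (h + 1) n := by
  rw [pathPermsTail, sum_paths_succ hh]
  simp only [not_lt_zero, IsEmpty.forall_iff, implies_true, if_true, zero_add, flatAt_cons_succ,
    Nat.sub_zero]
  change ∑ l, pathPerms (h + bitWeight l) n = _
  rw [sum_bool_prod_bitWeight fun d => pathPerms (h + d) n, add_zero, two_mul, ← sub_eq_add_neg]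

theorem pathPerms_of_neg {h : ℤ} (hh : h < 0) (n : ℕ) : pathPerms h n = 0 := by
  simp [pathPerms, paths_eq_empty hh]

end PathPerms

section GeneratingFunctions

open PowerSeries

variable {R : Type*} [CommRing R]

theorem eq_zero_of_forall_eq_mul_add {u : R⟦X⟧} (hu : constantCoeff u = 0) {D : ℤ → R⟦X⟧}
    (hneg : ∀ h < 0, D h = 0)
    (hrec : ∀ h, 0 ≤ h → D h = u * (D (h - 1) + D h + D (h + 1))) (h : ℤ) : D h = 0 := by
  ext n
  induction n using Nat.strong_induction_on generalizing h with
  | _ n ih =>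
    rcases lt_or_ge h 0 with hh | hh
    · rw [hneg h hh]
    rw [hrec h hh, coeff_mul, map_zero]
    refine Finset.sum_eq_zero fun p hp => ?_
    rw [Finset.HasAntidiagonal.mem_antidiagonal] at hp
    rcases Nat.eq_zero_or_pos p.1 with h0 | h0
    · rw [h0, coeff_zero_eq_constantCoeff_apply, hu, zero_mul]
    · rw [map_add, map_add, ih _ (by omega), ih _ (by omega), ih _ (by omega)]
      simp

theorem catalanGF_eq : catalanGF = 1 + X * catalanGF ^ 2 := by
  have hmap : PowerSeries.map (Nat.castRingHom ℚ) catalanSeries = catalanGF := by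
    ext n
    simp [catalanSeries, catalanGF]
  have h := congrArg (PowerSeries.map (Nat.castRingHom ℚ)) catalanSeries_sq_mul_X_add_one
  rw [map_add, map_mul, map_pow, map_one, PowerSeries.map_X, hmap] at h
  linear_combination -h

theorem constantCoeff_catalanGF_sub_one : constantCoeff (catalanGF - 1) = 0 := by
  rw [sub_eq_iff_eq_add'.2 catalanGF_eq, map_mul, constantCoeff_X, zero_mul]

/-- The generating function of `pathPerms`. -/
noncomputable def pathPermsGF (h : ℤ) : ℚ⟦X⟧ := PowerSeries.mk fun n => (pathPerms h n : ℚ)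

theorem pathPermsGF_of_neg {h : ℤ} (hh : h < 0) : pathPermsGF h = 0 := by
  ext n
  simp [pathPermsGF, pathPerms_of_neg hh]

theorem pathPermsGF_eq {h : ℤ} (hh : 0 ≤ h) : pathPermsGF h = catalanGF *
    ((if h = 0 then 1 else 0) +
      X * (pathPermsGF (h - 1) + 2 * pathPermsGF h + pathPermsGF (h + 1))) := by
  have hconv : pathPermsGF h = catalanGF * PowerSeries.mk fun n => (pathPermsTail 0 h n : ℚ) := by
    ext n
    rw [coeff_mul, Finset.Nat.sum_antidiagonal_eq_sum_range_succ_mk, pathPermsGF, coeff_mk,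
      pathPerms_eq_sum]
    simp [catalanGF]
  have htail : (PowerSeries.mk fun n => (pathPermsTail 0 h (n + 1) : ℚ)) =
      pathPermsGF (h - 1) + 2 * pathPermsGF h + pathPermsGF (h + 1) := by
    ext n
    rw [two_mul]
    simp [pathPermsGF, pathPermsTail_zero_succ hh, two_mul]
  rw [← htail, hconv, eq_X_mul_shift_add_const (PowerSeries.mk _), add_comm]
  simp [← coeff_zero_eq_constantCoeff_apply, pathPermsTail_zero_zero, apply_ite]

theorem X_mul_pathPermsGF_eq {h : ℤ} (hh : 0 ≤ h) : X * pathPermsGF h = (catalanGF - 1) *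
    ((if h = 0 then 1 else 0) +
      (X * pathPermsGF (h - 1) + X * pathPermsGF h + X * pathPermsGF (h + 1))) := by
  linear_combination X * catalanGF * pathPermsGF_eq hh -
    ((if h = 0 then 1 else 0) +
      X * (pathPermsGF (h - 1) + 2 * pathPermsGF h + pathPermsGF (h + 1))) * catalanGF_eq

/-- The generating function of the Motzkin paths that start at height `h`. -/
noncomputable def motzkinPathGF (h : ℤ) : ℚ⟦X⟧ :=
  PowerSeries.mk fun n => ((paths (fun s : SignType => (s : ℤ)) h n).card : ℚ)

theorem motzkinPathGF_zero : motzkinPathGF 0 = motzkinGF := by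
  ext n
  simp only [motzkinPathGF, motzkinGF, coeff_mk, motzkin]
  rw [← Set.ncard_coe_finset]
  congr 2
  ext s
  simp [mem_paths, motzkinPaths]

theorem motzkinPathGF_of_neg {h : ℤ} (hh : h < 0) : motzkinPathGF h = 0 := by
  ext n
  simp [motzkinPathGF, paths_eq_empty hh]

theorem motzkinPathGF_eq {h : ℤ} (hh : 0 ≤ h) : motzkinPathGF h =
    (if h = 0 then 1 else 0) +
      X * (motzkinPathGF (h - 1) + motzkinPathGF h + motzkinPathGF (h + 1)) := by
  have hzero : (paths (fun s : SignType => (s : ℤ)) h 0).card = if h = 0 then 1 else 0 := by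
    rw [Finset.card_eq_sum_ones, sum_paths_zero]
  have hsucc :
      (PowerSeries.mk fun n => ((paths (fun s : SignType => (s : ℤ)) h (n + 1)).card : ℚ)) =
        motzkinPathGF (h - 1) + motzkinPathGF h + motzkinPathGF (h + 1) := by
    have hu : (Finset.univ : Finset SignType) = {0, -1, 1} := rfl
    ext n
    simp only [motzkinPathGF, map_add, coeff_mk, Finset.card_eq_sum_ones, sum_paths_succ hh]
    rw [hu, Finset.sum_insert (by decide), Finset.sum_insert (by decide), Finset.sum_singleton]
    simp [sub_eq_add_neg]
    ring
  rw [← hsucc, motzkinPathGF, eq_X_mul_shift_add_const (PowerSeries.mk _), add_comm]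
  simp [← coeff_zero_eq_constantCoeff_apply, hzero, apply_ite]

theorem mul_subst_motzkinPathGF_eq {u : ℚ⟦X⟧} (hu : constantCoeff u = 0) {h : ℤ} (hh : 0 ≤ h) :
    u * (motzkinPathGF h).subst u = u * ((if h = 0 then 1 else 0) +
      (u * (motzkinPathGF (h - 1)).subst u + u * (motzkinPathGF h).subst u +
        u * (motzkinPathGF (h + 1)).subst u)) := by
  have hs : HasSubst u := HasSubst.of_constantCoeff_zero' hu
  have hrec := congrArg (substAlgHom (R := ℚ) hs) (motzkinPathGF_eq hh)
  rw [map_add, map_mul, map_add, map_add, substAlgHom_X, apply_ite (substAlgHom hs), map_one,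
    map_zero] at hrec
  simp only [coe_substAlgHom] at hrec
  linear_combination u * hrec

theorem seriesA_eq : seriesA = X * pathPermsGF 0 := by
  have hu := constantCoeff_catalanGF_sub_one
  have hD := eq_zero_of_forall_eq_mul_add hu (D := fun h => X * pathPermsGF h -
    (catalanGF - 1) * (motzkinPathGF h).subst (catalanGF - 1))
    (fun h hh => by
      simp [pathPermsGF_of_neg hh, motzkinPathGF_of_neg hh,
        ← coe_substAlgHom (HasSubst.of_constantCoeff_zero' hu)])
    (fun h hh => by
      linear_combination X_mul_pathPermsGF_eq hh - mul_subst_motzkinPathGF_eq hu hh) 0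
  rw [seriesA, ← motzkinPathGF_zero, sub_eq_zero.1 hD]

end GeneratingFunctions

section Count

variable {p q : ℕ → Prop} [DecidablePred p] [DecidablePred q] {a b c k n : ℕ}

theorem isLeast_le_count_iff :
    IsLeast {v | c ≤ Nat.count p v} a ↔ Nat.count p a = c ∧ ∀ b, a = b + 1 → p b := by
  constructor
  · rintro ⟨hmem : c ≤ Nat.count p a, hleast⟩
    rcases a with _ | b
    · simpa [eq_comm] using hmem
    have hlt : Nat.count p b < c := not_le.1 fun hb => (hleast hb).not_gt b.lt_succ_self
    have hb : p b := Nat.count_lt_count_succ_iff.1 (hlt.trans_le hmem)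
    refine ⟨?_, fun b' h => Nat.succ_injective h ▸ hb⟩
    have := Nat.count_succ_eq_succ_count_iff.2 hb
    omega
  · rintro ⟨rfl, hpred⟩
    refine ⟨le_refl (Nat.count p a), fun v (hv : Nat.count p a ≤ Nat.count p v) => ?_⟩
    by_contra! hlt
    obtain ⟨b, rfl⟩ := Nat.exists_eq_add_one_of_ne_zero (Nat.ne_zero_of_lt hlt)
    exact (Nat.count_lt_count_succ_iff.2 (hpred b rfl)).not_ge
      (hv.trans (Nat.count_monotone p (Nat.lt_succ_iff.1 hlt)))

theorem exists_isLeast_le_count (h : c ≤ Nat.count p b) :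
    ∃ a ≤ b, IsLeast {v | c ≤ Nat.count p v} a :=
  ⟨Nat.find ⟨b, h⟩, Nat.find_min' ⟨b, h⟩ h, Nat.isLeast_find ⟨b, h⟩⟩

theorem ne_iff_of_isLeast (ha : IsLeast {v | Nat.count p k ≤ Nat.count q v} a)
    (hb : IsLeast {v | Nat.count p (k + 1) ≤ Nat.count q v} b) : b ≠ a ↔ p k := by
  refine ⟨fun hne => by_contra fun hk => ?_, fun hk hba => ?_⟩
  · rw [Nat.count_succ_eq_count_iff.2 hk] at hb
    exact hne (hb.unique ha)
  · have hca := (isLeast_le_count_iff.1 ha).1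
    have hcb := (isLeast_le_count_iff.1 hb).1
    have := Nat.count_succ_eq_succ_count_iff.2 hk
    rw [hba] at hcb
    omega

theorem exists_isLeast_succ_iff (hle : Nat.count q (b + 1) ≤ Nat.count p n) :
    (∃ i ≤ n, IsLeast {v | Nat.count p i ≤ Nat.count q v} (b + 1)) ↔ q b := by
  constructor
  · rintro ⟨i, -, hi⟩
    exact (isLeast_le_count_iff.1 hi).2 b rfl
  · intro hb
    obtain ⟨i, hin, hi⟩ := exists_isLeast_le_count hle
    exact ⟨i, hin, isLeast_le_count_iff.2
      ⟨(isLeast_le_count_iff.1 hi).1.symm, fun b' h => Nat.succ_injective h ▸ hb⟩⟩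

theorem cast_count_exists_fin (p : Fin n → Prop) [DecidablePred p] (k : ℕ) :
    (Nat.count (fun j => ∃ hj : j < n, p ⟨j, hj⟩) k : ℤ) =
      ∑ i : Fin n with i.val < k, if p i then 1 else 0 := by
  rw [Finset.sum_boole, Finset.filter_filter, Nat.count_eq_card_filter_range]
  refine congrArg _ (Finset.card_bij' (fun j hj => ⟨j, ?_⟩) (fun i _ => i.val) ?_ ?_ ?_ ?_)
  · exact (Finset.mem_filter.1 hj).2.1
  · intro j hj
    obtain ⟨hjk, hjn, hp⟩ := Finset.mem_filter.1 hj
    exact Finset.mem_filter_univ _ |>.2 ⟨Finset.mem_range.1 hjk, hp⟩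
  · intro i hi
    obtain ⟨hik, hp⟩ := (Finset.mem_filter_univ _).1 hi
    exact Finset.mem_filter.2 ⟨Finset.mem_range.2 hik, i.isLt, hp⟩
  · exact fun _ _ => rfl
  · exact fun _ _ => rfl

end Count

section Ballot

variable {n : ℕ}

/-- The positions where the first bit of a word is set. -/
def firstBit (w : Fin n → Bool × Bool) (j : ℕ) : Prop := ∃ hj : j < n, (w ⟨j, hj⟩).1 = true

/-- The positions where the second bit of a word is set. -/
def secondBit (w : Fin n → Bool × Bool) (j : ℕ) : Prop := ∃ hj : j < n, (w ⟨j, hj⟩).2 = true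

instance (w : Fin n → Bool × Bool) : DecidablePred (firstBit w) :=
  fun j => inferInstanceAs (Decidable (∃ hj : j < n, (w ⟨j, hj⟩).1 = true))

instance (w : Fin n → Bool × Bool) : DecidablePred (secondBit w) :=
  fun j => inferInstanceAs (Decidable (∃ hj : j < n, (w ⟨j, hj⟩).2 = true))

theorem sum_bitWeight (w : Fin n → Bool × Bool) (k : ℕ) :
    ∑ i : Fin n with i.val < k, bitWeight (w i) =
      (Nat.count (secondBit w) k : ℤ) - Nat.count (firstBit w) k := by
  have hfirst := cast_count_exists_fin (fun i => (w i).1 = true) k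
  have hsecond := cast_count_exists_fin (fun i => (w i).2 = true) k
  simp only [bitWeight, Finset.sum_sub_distrib]
  exact congrArg₂ _ hsecond.symm hfirst.symm

theorem mem_paths_bitWeight {w : Fin n → Bool × Bool} : w ∈ paths bitWeight 0 n ↔
    (∀ k, Nat.count (firstBit w) k ≤ Nat.count (secondBit w) k) ∧
      Nat.count (firstBit w) n = Nat.count (secondBit w) n := by
  have htotal := sum_bitWeight w n
  simp only [Fin.is_lt, Finset.filter_true] at htotal
  rw [mem_paths, htotal]
  simp only [sum_bitWeight, zero_add, sub_nonneg, Nat.cast_le, sub_eq_zero, Nat.cast_inj]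
  exact and_congr_right fun _ => eq_comm

open Classical in
/-- The monotone sequences that do not exceed the identity. -/
noncomputable def ballot (n : ℕ) : Finset (Fin n → Fin n) :=
  Finset.univ.filter fun α => Monotone α ∧ ∀ k, α k ≤ k

theorem mem_ballot {α : Fin n → Fin n} : α ∈ ballot n ↔ Monotone α ∧ ∀ k, α k ≤ k := by
  simp only [ballot, Finset.mem_filter_univ]

/-- The sequence `α` is constant between `j` and `j + 1`, and does not take the value `j + 1`. -/
def joinedAt (α : Fin n → Fin n) (j : ℕ) : Prop :=
  ∃ hj : j + 1 < n, α ⟨j + 1, hj⟩ = α ⟨j, by omega⟩ ∧ ∀ i, (α i).val ≠ j + 1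

/-- The word that records the jumps of a sequence in the first bits and its values in the second
bits. -/
def ballotWord (α : Fin (n + 1) → Fin (n + 1)) (k : Fin n) : Bool × Bool :=
  (decide (α k.succ ≠ α k.castSucc), decide (∃ i, α i = k.succ))

variable {α β : Fin (n + 1) → Fin (n + 1)}

theorem firstBit_ballotWord {j : ℕ} (hj : j < n) :
    firstBit (ballotWord α) j ↔ α ⟨j + 1, by omega⟩ ≠ α ⟨j, by omega⟩ := by
  simp only [firstBit, ballotWord, decide_eq_true_eq, hj, exists_true_left]
  rfl

theorem secondBit_ballotWord {j : ℕ} :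
    secondBit (ballotWord α) j ↔ ∃ i, (α i).val = j + 1 := by
  simp only [secondBit, ballotWord, decide_eq_true_eq, Fin.ext_iff, Fin.val_succ]
  exact ⟨fun ⟨_, hi⟩ => hi, fun ⟨i, hi⟩ => ⟨by omega, i, hi⟩⟩

theorem flatAt_ballotWord {j : ℕ} : flatAt (ballotWord α) j ↔ joinedAt α j := by
  simp only [flatAt, joinedAt, ballotWord, Prod.mk.injEq, decide_eq_false_iff_not, not_not,
    not_exists, Fin.ext_iff, Fin.val_succ, Nat.add_lt_add_iff_right]
  rfl

theorem count_ballotWord (hα : α ∈ ballot (n + 1)) (k : Fin (n + 1)) :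
    Nat.count (firstBit (ballotWord α)) k = Nat.count (secondBit (ballotWord α)) (α k) := by
  obtain ⟨hmono, hdiag⟩ := mem_ballot.1 hα
  induction k using Fin.induction with
  | zero => simp [Fin.le_zero_iff.1 (hdiag 0)]
  | succ k ih =>
    have hbit : firstBit (ballotWord α) k ↔ α k.succ ≠ α k.castSucc := firstBit_ballotWord k.isLt
    rw [Fin.val_succ, Nat.count_succ, ← Fin.val_castSucc k, ih]
    split_ifs with hjump
    · have hlt := (hmono k.castSucc_lt_succ.le).lt_of_ne (hbit.1 hjump).symm
      obtain ⟨b, hb⟩ := Nat.exists_eq_add_one_of_ne_zero (Nat.ne_zero_of_lt hlt)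
      have hskip : Nat.count (secondBit (ballotWord α)) b ≤
          Nat.count (secondBit (ballotWord α)) (α k.castSucc) := by
        by_contra! hcount
        obtain ⟨v, ⟨hkv, hvb⟩, hv⟩ := Nat.exists_of_count_lt_count hcount
        obtain ⟨i, hi⟩ := secondBit_ballotWord.1 hv
        rcases le_or_gt i k.castSucc with hik | hik
        · have := Fin.le_def.1 (hmono hik)
          omega
        · have := Fin.le_def.1 (hmono (Fin.castSucc_lt_iff_succ_le.1 hik))
          omega
      have hle := Nat.count_monotone (secondBit (ballotWord α))
        (show (α k.castSucc).val ≤ b by rw [Fin.lt_def] at hlt; omega)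
      rw [hb, Nat.count_succ, if_pos (secondBit_ballotWord.2 ⟨_, hb⟩), hskip.antisymm hle]
    · rw [add_zero, not_not.1 fun h => hjump (hbit.2 h)]

theorem isLeast_ballotWord (hα : α ∈ ballot (n + 1)) (k : Fin (n + 1)) :
    IsLeast {v | Nat.count (firstBit (ballotWord α)) k ≤ Nat.count (secondBit (ballotWord α)) v}
      (α k).val :=
  isLeast_le_count_iff.2 ⟨(count_ballotWord hα k).symm, fun _ hb => secondBit_ballotWord.2 ⟨k, hb⟩⟩

theorem ballotWord_injOn : Set.InjOn (ballotWord (n := n)) (ballot (n + 1)) := by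
  intro α hα β hβ h
  funext k
  have hαk := isLeast_ballotWord hα k
  rw [h] at hαk
  exact Fin.ext (hαk.unique (isLeast_ballotWord hβ k))

theorem ballotWord_mem_paths (hα : α ∈ ballot (n + 1)) : ballotWord α ∈ paths bitWeight 0 n := by
  obtain ⟨hmono, hdiag⟩ := mem_ballot.1 hα
  have hle (k : Fin (n + 1)) : Nat.count (firstBit (ballotWord α)) k ≤
      Nat.count (secondBit (ballotWord α)) k := by
    rw [count_ballotWord hα k]
    exact Nat.count_monotone _ (hdiag k)
  refine mem_paths_bitWeight.2 ⟨fun k => ?_, (hle (Fin.last n)).antisymm ?_⟩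
  · rcases lt_or_ge n k with hk | hk
    · refine le_trans ?_ ((hle (Fin.last n)).trans (Nat.count_monotone _ hk.le))
      by_contra! hlt
      obtain ⟨x, ⟨hnx, -⟩, hxn, -⟩ := Nat.exists_of_count_lt_count hlt
      exact hxn.not_ge hnx
    · exact hle ⟨k, by omega⟩
  · by_contra! hlt
    rw [count_ballotWord hα (Fin.last n)] at hlt
    obtain ⟨v, ⟨hv, -⟩, hbit⟩ := Nat.exists_of_count_lt_count hlt
    obtain ⟨i, hi⟩ := secondBit_ballotWord.1 hbit
    have := Fin.le_def.1 (hmono (Fin.le_last i))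
    omega

theorem exists_ballotWord_eq {w : Fin n → Bool × Bool} (hw : w ∈ paths bitWeight 0 n) :
    ∃ α ∈ ballot (n + 1), ballotWord α = w := by
  obtain ⟨hle, htotal⟩ := mem_paths_bitWeight.1 hw
  choose f hf hleast using fun k : Fin (n + 1) =>
    exists_isLeast_le_count (p := secondBit w) (hle k)
  have hmono (k l : Fin (n + 1)) (hkl : k ≤ l) : f k ≤ f l :=
    (hleast k).2 ((Nat.count_monotone _ hkl).trans (hleast l).1)
  refine ⟨fun k => ⟨f k, (hf k).trans_lt k.isLt⟩, mem_ballot.2 ⟨hmono, hf⟩, ?_⟩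
  funext k
  have hfirst : f k.succ ≠ f k.castSucc ↔ firstBit w k :=
    ne_iff_of_isLeast (hleast k.castSucc) (hleast k.succ)
  have hsecond : (∃ i, f i = k.val + 1) ↔ secondBit w k := by
    have hcount : Nat.count (secondBit w) (k + 1) ≤ Nat.count (firstBit w) n :=
      htotal ▸ Nat.count_monotone (secondBit w) k.isLt
    rw [← exists_isLeast_succ_iff hcount]
    exact ⟨fun ⟨i, hi⟩ => ⟨i, i.is_le, hi ▸ hleast i⟩,
      fun ⟨i, hin, hi⟩ => ⟨⟨i, by omega⟩, (hleast ⟨i, by omega⟩).unique hi⟩⟩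
  simp only [firstBit, secondBit, k.isLt, exists_true_left] at hfirst hsecond
  refine Prod.ext (Bool.eq_iff_iff.2 ?_) (Bool.eq_iff_iff.2 ?_)
  · simp only [ballotWord, decide_eq_true_eq, Fin.ne_iff_vne, hfirst]
  · simp only [ballotWord, decide_eq_true_eq, Fin.ext_iff, Fin.val_succ, hsecond]

theorem sum_ballot (n : ℕ) : ∑ α ∈ ballot (n + 1), (avJoined (n + 1) (joinedAt α)).ncard =
    pathPerms 0 n := by
  refine Finset.sum_nbij ballotWord (fun _ => ballotWord_mem_paths) ballotWord_injOn
    (fun _ => exists_ballotWord_eq) fun α _ => ?_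
  rw [avJoined_congr fun _ _ => flatAt_ballotWord]

end Ballot

section Positions

variable {n : ℕ} {α : Fin n → Fin n}

/-- The sequence conjugate to `α`, in the sense of partitions. -/
def conjSeq (α : Fin n → Fin n) (k : Fin n) : ℕ :=
  (Finset.univ.filter fun j => α j ≤ k).card

theorem lt_conjSeq_iff (hα : Monotone α) {j k : Fin n} : j.val < conjSeq α k ↔ α j ≤ k :=
  Tuple.lt_card_le_iff_apply_le_of_monotone hα

theorem conjSeq_le (α : Fin n → Fin n) (k : Fin n) : conjSeq α k ≤ n :=
  (Finset.card_le_univ _).trans_eq (Fintype.card_fin n)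

theorem conjSeq_mono (α : Fin n → Fin n) : Monotone (conjSeq α) := fun _ _ hjk =>
  Finset.card_le_card <| Finset.monotone_filter_right _ fun _ _ hi => le_trans hi hjk

/-- The position of a smallest element of a cycle. -/
def minPos (i : Fin n) : Fin (3 * n) := ⟨i.val, by omega⟩

/-- The position of a middle element of a cycle, in the permutations coded by `α`: to its left
there are `n` smallest elements, `k` middle elements, and `α k` largest elements. -/
def midPos (α : Fin n → Fin n) (k : Fin n) : Fin (3 * n) := ⟨n + k.val + (α k).val, by omega⟩

/-- The position of a largest element of a cycle, in the permutations coded by `α`: to its left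
there are `n` smallest elements, `k` largest elements, and `conjSeq α k` middle elements. -/
def maxPos (α : Fin n → Fin n) (k : Fin n) : Fin (3 * n) :=
  ⟨n + k.val + conjSeq α k, by have := conjSeq_le α k; omega⟩

theorem minPos_strictMono (n : ℕ) : StrictMono (minPos (n := n)) := fun _ _ h => h

theorem midPos_strictMono (hα : Monotone α) : StrictMono (midPos α) := by
  intro j k hjk
  have := hα hjk.le
  simp only [Fin.lt_def, Fin.le_def, midPos] at *
  omega

theorem maxPos_strictMono (α : Fin n → Fin n) : StrictMono (maxPos α) := by
  intro j k hjk
  have := conjSeq_mono α hjk.le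
  simp only [Fin.lt_def, maxPos] at *
  omega

theorem minPos_lt_midPos (i k : Fin n) : minPos i < midPos α k := by
  simp only [Fin.lt_def, minPos, midPos]
  omega

theorem minPos_lt_maxPos (i k : Fin n) : minPos i < maxPos α k := by
  simp only [Fin.lt_def, minPos, maxPos]
  omega

theorem midPos_lt_maxPos_iff (hα : Monotone α) {j k : Fin n} :
    midPos α j < maxPos α k ↔ α j ≤ k := by
  have := lt_conjSeq_iff hα (j := j) (k := k)
  simp only [Fin.lt_def, Fin.le_def, midPos, maxPos] at *
  omega

theorem maxPos_lt_midPos_iff (hα : Monotone α) {j k : Fin n} :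
    maxPos α k < midPos α j ↔ k < α j := by
  have := lt_conjSeq_iff hα (j := j) (k := k)
  simp only [Fin.lt_def, Fin.le_def, midPos, maxPos] at *
  omega

theorem bijective_elim_minPos_midPos_maxPos (hα : Monotone α) :
    Function.Bijective (Sum.elim minPos (Sum.elim (midPos α) (maxPos α))) := by
  rw [Fintype.bijective_iff_injective_and_card]
  refine ⟨(minPos_strictMono n).injective.sumElim
    ((midPos_strictMono hα).injective.sumElim (maxPos_strictMono α).injective ?_) ?_, ?_⟩
  · intro j k h
    have hlt := midPos_lt_maxPos_iff hα (j := j) (k := k)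
    have hgt := maxPos_lt_midPos_iff hα (j := j) (k := k)
    rw [h, lt_self_iff_false, false_iff] at hlt hgt
    exact hgt (not_le.1 hlt)
  · rintro i (k | k)
    · exact (minPos_lt_midPos i k).ne
    · exact (minPos_lt_maxPos i k).ne
  · simp
    omega

theorem val_eq_card_of_bijective {ι : Type*} [Fintype ι] {N : ℕ} {f : ι → Fin N}
    (hf : Function.Bijective f) (y : Fin N) :
    y.val = (Finset.univ.filter fun i => f i < y).card := by
  rw [← Fin.card_Iio y]
  exact (Finset.card_bijective f hf fun i => by simp).symm

theorem val_eq_add_of_bijective_elim {ι₁ ι₂ ι₃ : Type*} [Fintype ι₁] [Fintype ι₂] [Fintype ι₃]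
    {N : ℕ} {p : ι₁ → Fin N} {q : ι₂ → Fin N} {r : ι₃ → Fin N}
    (hf : Function.Bijective (Sum.elim p (Sum.elim q r))) (y : Fin N) :
    y.val = (Finset.univ.filter fun i => p i < y).card +
      (Finset.univ.filter fun j => q j < y).card + (Finset.univ.filter fun k => r k < y).card := by
  rw [val_eq_card_of_bijective hf]
  simp only [Finset.card_filter, Fintype.sum_sum_type, add_assoc]
  rfl

theorem card_filter_minPos_lt {y : Fin (3 * n)} (hy : n ≤ y.val) :
    (Finset.univ.filter fun i : Fin n => minPos i < y).card = n := by
  rw [Finset.filter_true_of_mem fun i _ => Fin.lt_def.2 (i.isLt.trans_le hy), Finset.card_univ,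
    Fintype.card_fin]

theorem exists_midPos_eq_and_maxPos_eq {q r : Fin n → Fin (3 * n)} (hq : StrictMono q)
    (hr : StrictMono r) (hb : Function.Bijective (Sum.elim minPos (Sum.elim q r)))
    (hqr : ∀ k, q k < r k) : ∃ α ∈ ballot n, midPos α = q ∧ maxPos α = r := by
  have hne (j k : Fin n) : q j ≠ r k := fun h => by
    simpa using hb.injective (a₁ := Sum.inr (Sum.inl j)) (a₂ := Sum.inr (Sum.inr k)) h
  have hminq (k : Fin n) := card_filter_minPos_lt (y := q k) <| not_lt.1 fun h => by
    simpa using hb.injective (a₁ := Sum.inl ⟨q k, h⟩) (a₂ := Sum.inr (Sum.inl k)) rfl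
  have hminr (k : Fin n) := card_filter_minPos_lt (y := r k) <| not_lt.1 fun h => by
    simpa using hb.injective (a₁ := Sum.inl ⟨r k, h⟩) (a₂ := Sum.inr (Sum.inr k)) rfl
  let a (k : Fin n) : ℕ := (Finset.univ.filter fun j => r j < q k).card
  have ha (j k : Fin n) : j.val < a k ↔ r j < q k :=
    Tuple.lt_card_lt_iff_apply_lt_of_monotone hr.monotone
  have hak (k : Fin n) : a k ≤ k.val := not_lt.1 fun h => ((ha k k).1 h).asymm (hqr k)
  let α (k : Fin n) : Fin n := ⟨a k, (hak k).trans_lt k.isLt⟩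
  have hα (j k : Fin n) : α j ≤ k ↔ q j < r k := by
    rw [← not_lt, Fin.lt_def, ha, not_lt, (hne j k).le_iff_lt]
  have hcard (k : Fin n) : (Finset.univ.filter (· < k)).card = k.val := by
    rw [Finset.filter_gt_eq_Iio, Fin.card_Iio]
  refine ⟨α, mem_ballot.2 ⟨fun j k hjk => ?_, hak⟩, ?_, ?_⟩
  · change a j ≤ a k
    exact Finset.card_le_card <|
      Finset.monotone_filter_right _ fun _ _ hi => lt_of_lt_of_le hi (hq.monotone hjk)
  · ext k
    rw [val_eq_add_of_bijective_elim hb (q k), hminq]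
    simp only [hq.lt_iff_lt, hcard, midPos, α, a]
  · ext k
    rw [val_eq_add_of_bijective_elim hb (r k), hminr]
    simp only [hr.lt_iff_lt, hcard, maxPos, conjSeq, hα]
    omega

end Positions

section PermOfCode

variable {n : ℕ} {α : Fin n → Fin n} (hα : Monotone α) (τ : Perm (Fin n))

/-- The permutation of the three kinds of positions in which the middle element of rank `k` is sent
to the smallest element `τ k`, which is sent to the largest element of rank `k`. -/
def basePerm : Perm (Fin n ⊕ (Fin n ⊕ Fin n)) where
  toFun := Sum.elim (fun i => Sum.inr (Sum.inr (τ.symm i)))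
    (Sum.elim (fun k => Sum.inl (τ k)) fun k => Sum.inr (Sum.inl k))
  invFun := Sum.elim (fun i => Sum.inr (Sum.inl (τ.symm i)))
    (Sum.elim (fun k => Sum.inr (Sum.inr k)) fun k => Sum.inl (τ k))
  left_inv := by rintro (i | k | k) <;> simp
  right_inv := by rintro (i | k | k) <;> simp

theorem isThreeCyclic_basePerm : IsThreeCyclic (basePerm τ) where
  apply_ne := by rintro (i | k | k) <;> simp [basePerm]
  apply_apply_apply := by rintro (i | k | k) <;> simp [basePerm]

/-- The three kinds of positions together. -/
noncomputable def posEquiv : Fin n ⊕ (Fin n ⊕ Fin n) ≃ Fin (3 * n) :=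
  Equiv.ofBijective _ (bijective_elim_minPos_midPos_maxPos hα)

/-- The permutation with cycles of the form `312` in which the positions of the middle and largest
elements are given by `α`, and the smallest element of the cycle of rank `k` is `τ k`. -/
noncomputable def permOfCode : Perm (Fin (3 * n)) := (posEquiv hα).permCongr (basePerm τ)

theorem permOfCode_posEquiv (z : Fin n ⊕ (Fin n ⊕ Fin n)) :
    permOfCode hα τ (posEquiv hα z) = posEquiv hα (basePerm τ z) := by
  rw [permOfCode, Equiv.permCongr_apply, Equiv.symm_apply_apply]

theorem permOfCode_minPos (k : Fin n) : permOfCode hα τ (minPos (τ k)) = maxPos α k := by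
  simpa [posEquiv, basePerm] using permOfCode_posEquiv hα τ (Sum.inl (τ k))

theorem permOfCode_midPos (k : Fin n) : permOfCode hα τ (midPos α k) = minPos (τ k) :=
  permOfCode_posEquiv hα τ (Sum.inr (Sum.inl k))

theorem permOfCode_maxPos (k : Fin n) : permOfCode hα τ (maxPos α k) = midPos α k :=
  permOfCode_posEquiv hα τ (Sum.inr (Sum.inr k))

include hα in
theorem eq_minPos_or_eq_midPos_or_eq_maxPos (y : Fin (3 * n)) :
    (∃ k, y = minPos (τ k)) ∨ (∃ k, y = midPos α k) ∨ ∃ k, y = maxPos α k := by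
  obtain ⟨z | z | z, rfl⟩ := (bijective_elim_minPos_midPos_maxPos hα).surjective y
  · exact Or.inl ⟨τ.symm z, by simp⟩
  · exact Or.inr (Or.inl ⟨z, rfl⟩)
  · exact Or.inr (Or.inr ⟨z, rfl⟩)

theorem isThreeCyclic_permOfCode : IsThreeCyclic (permOfCode hα τ) :=
  (isThreeCyclic_permCongr_iff _).2 (isThreeCyclic_basePerm τ)

include hα in
theorem forall_joinedAt_iff {k l : Fin n} (hkl : k ≤ l) :
    (∀ j : ℕ, k.val ≤ j → j < l.val → joinedAt α j) ↔
      α l ≤ α k ∧ ∀ i, ¬ (k < α i ∧ α i ≤ l) := by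
  constructor
  · intro h
    refine ⟨?_, fun i ⟨hki, _⟩ => ?_⟩
    · obtain ⟨k, hk⟩ := k
      obtain ⟨l, hl⟩ := l
      replace hkl : k ≤ l := hkl
      induction l, hkl using Nat.le_induction with
      | base => exact le_rfl
      | succ l hkl ih =>
        obtain ⟨_, heq, -⟩ := h l hkl l.lt_succ_self
        rw [heq]
        exact ih (by omega) fun j hj hjl => h j hj (hjl.trans l.lt_succ_self)
    · obtain ⟨j, hj⟩ := Nat.exists_eq_add_one_of_ne_zero (Nat.ne_zero_of_lt hki)
      obtain ⟨-, -, hne⟩ := h j (by omega) (by omega)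
      exact hne i hj
  · rintro ⟨hle, hnot⟩ j hkj hjl
    refine ⟨by omega, le_antisymm ?_ (hα (Fin.mk_le_mk.2 j.le_succ)), fun i hi => ?_⟩
    · exact (hα (Fin.mk_le_mk.2 hjl)).trans (hle.trans (hα (Fin.mk_le_mk.2 hkj)))
    · exact hnot i ⟨by rw [Fin.lt_def]; omega, by rw [Fin.le_def]; omega⟩

include hα in
theorem mem_avJoined_joinedAt_iff : τ ∈ avJoined n (joinedAt α) ↔ Avoids132 τ ∧
    ∀ k l, k < l → τ k < τ l → α l ≤ α k ∧ ∀ i, ¬ (k < α i ∧ α i ≤ l) := by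
  refine and_congr_right fun _ => forall₃_congr fun k l hkl => ?_
  rw [forall_joinedAt_iff hα hkl.le]

theorem avoids132_permOfCode_iff :
    Avoids132 (permOfCode hα τ) ↔ τ ∈ avJoined n (joinedAt α) := by
  have hmid := midPos_strictMono hα
  have hmax := maxPos_strictMono α
  have hmin {j k : Fin n} : minPos j < minPos k ↔ j < k := (minPos_strictMono n).lt_iff_lt
  have hmidmin (i k : Fin n) : ¬ midPos α k < minPos i := (minPos_lt_midPos i k).asymm
  have hmaxmin (i k : Fin n) : ¬ maxPos α k < minPos i := (minPos_lt_maxPos i k).asymm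
  rw [mem_avJoined_joinedAt_iff hα τ]
  constructor
  · intro h
    refine ⟨fun a b c hab hbc hac hcb => ?_, fun k l _ hτ => ⟨not_lt.1 fun hlt => ?_, ?_⟩⟩
    · refine h (hmid hab) (hmid hbc) ?_ ?_ <;> simpa only [permOfCode_midPos]
    · refine h ((midPos_lt_maxPos_iff hα).2 (le_refl (α k))) ((maxPos_lt_midPos_iff hα).2 hlt) ?_ ?_
      · simpa only [permOfCode_midPos]
      · simpa only [permOfCode_midPos, permOfCode_maxPos] using minPos_lt_midPos _ _
    · rintro i ⟨hki, hil⟩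
      refine h (hmin.2 hτ) (minPos_lt_maxPos (α := α) (τ l) i) ?_ ?_ <;>
        simpa only [permOfCode_minPos, permOfCode_maxPos, maxPos_lt_midPos_iff hα,
          midPos_lt_maxPos_iff hα]
  · rintro ⟨hτ, hjoined⟩ a b c hab hbc hac hcb
    rcases eq_minPos_or_eq_midPos_or_eq_maxPos hα τ a with ⟨k, rfl⟩ | ⟨k, rfl⟩ | ⟨k, rfl⟩ <;>
    rcases eq_minPos_or_eq_midPos_or_eq_maxPos hα τ b with ⟨l, rfl⟩ | ⟨l, rfl⟩ | ⟨l, rfl⟩ <;>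
    rcases eq_minPos_or_eq_midPos_or_eq_maxPos hα τ c with ⟨m, rfl⟩ | ⟨m, rfl⟩ | ⟨m, rfl⟩ <;>
    simp only [permOfCode_minPos, permOfCode_midPos, permOfCode_maxPos, hmin, minPos_lt_midPos,
      minPos_lt_maxPos, midPos_lt_maxPos_iff hα, maxPos_lt_midPos_iff hα, hmid.lt_iff_lt,
      hmax.lt_iff_lt, hmidmin, hmaxmin] at hab hbc hac hcb
    · exact hτ hac hcb hab hbc
    · exact (hjoined k l (hac.trans_le hcb) hab).2 m ⟨hac, hcb⟩
    · omega
    · exact hτ hab hbc hac hcb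
    · have hlt : α k < α m := hab.trans_lt hbc
      exact (hjoined k m (hα.reflect_lt hlt) hac).1.not_gt hlt
    all_goals omega

theorem permOfCode_mem_setA_iff (hdiag : ∀ k, α k ≤ k) :
    permOfCode hα τ ∈ setA n ↔ τ ∈ avJoined n (joinedAt α) := by
  rw [mem_setA_iff, mem_avStar_iff, avoids132_permOfCode_iff]
  refine ⟨fun h => h.1.2, fun h => ⟨⟨isThreeCyclic_permOfCode hα τ, h⟩, fun i hi => ?_⟩⟩
  obtain ⟨k, hk⟩ := τ.surjective ⟨i, hi⟩
  obtain rfl : minPos (τ k) = i := by rw [hk]; rfl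
  rw [permOfCode_minPos, permOfCode_maxPos, midPos_lt_maxPos_iff hα]
  exact hdiag k

theorem range_maxPos :
    Set.range (maxPos α) = {y | n ≤ y.val ∧ n ≤ (permOfCode hα τ y).val} := by
  have hmin (i : Fin n) : ¬ n ≤ (minPos i).val := not_le.2 i.isLt
  have hmid (k : Fin n) : n ≤ (midPos α k).val := by simp only [midPos]; omega
  have hmax (k : Fin n) : n ≤ (maxPos α k).val := by simp only [maxPos]; omega
  ext y
  constructor
  · rintro ⟨k, rfl⟩
    exact ⟨hmax k, permOfCode_maxPos hα τ k ▸ hmid k⟩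
  · rintro ⟨hy, hy'⟩
    rcases eq_minPos_or_eq_midPos_or_eq_maxPos hα τ y with ⟨k, rfl⟩ | ⟨k, rfl⟩ | ⟨k, rfl⟩
    · exact absurd hy (hmin _)
    · exact absurd (permOfCode_midPos hα τ k ▸ hy') (hmin _)
    · exact ⟨k, rfl⟩

end PermOfCode

theorem permOfCode_inj {n : ℕ} {α β : Fin n → Fin n} {hα : Monotone α} {hβ : Monotone β}
    {τ σ : Perm (Fin n)} (h : permOfCode hα τ = permOfCode hβ σ) : α = β ∧ τ = σ := by
  have hmax : maxPos α = maxPos β := by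
    rw [← (maxPos_strictMono α).range_inj (maxPos_strictMono β), range_maxPos hα τ,
      range_maxPos hβ σ, h]
  have hmid (k : Fin n) : midPos α k = midPos β k := by
    rw [← permOfCode_maxPos hα τ, ← permOfCode_maxPos hβ σ, h, hmax]
  have hmin (k : Fin n) : minPos (τ k) = minPos (σ k) := by
    rw [← permOfCode_midPos hα τ, ← permOfCode_midPos hβ σ, h, hmid]
  refine ⟨funext fun k => ?_, Equiv.ext fun k => (minPos_strictMono n).injective (hmin k)⟩
  simpa [midPos, Fin.val_inj] using hmid k

theorem IsThreeCyclic.bijective_elim {n : ℕ} {π : Perm (Fin (3 * n))} (h : IsThreeCyclic π)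
    (hπ : Avoids132 π) (τ : Perm (Fin n)) :
    Function.Bijective (Sum.elim minPos
      (Sum.elim (fun k => π (π (minPos (τ k)))) fun k => π (minPos (τ k)))) := by
  rw [Fintype.bijective_iff_surjective_and_card]
  refine ⟨fun y => ?_, ?_⟩
  · obtain ⟨i, hi, hy⟩ := h.exists_val_lt hπ y
    obtain ⟨k, hk⟩ := τ.surjective ⟨i, hi⟩
    obtain rfl : minPos (τ k) = i := by rw [hk]; rfl
    rcases hy with rfl | rfl | rfl
    · exact ⟨Sum.inl (τ k), rfl⟩
    · exact ⟨Sum.inr (Sum.inr k), rfl⟩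
    · exact ⟨Sum.inr (Sum.inl k), rfl⟩
  · simp only [Fintype.card_sum, Fintype.card_fin]
    omega

theorem exists_permOfCode_eq {n : ℕ} {π : Perm (Fin (3 * n))} (hπ : π ∈ setA n) :
    ∃ α, ∃ hα : α ∈ ballot n, ∃ τ, permOfCode (mem_ballot.1 hα).1 τ = π := by
  obtain ⟨hav, h312⟩ := mem_setA_iff.1 hπ
  obtain ⟨h, h132⟩ := mem_avStar_iff.1 hav
  let τ : Perm (Fin n) := Tuple.sort fun i => π (minPos i)
  have hup (k : Fin n) := h.le_val_apply h132 (i := minPos (τ k)) (τ k).isLt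
  have hr : StrictMono fun k => π (minPos (τ k)) :=
    (Tuple.monotone_sort fun i => π (minPos i)).strictMono_of_injective <|
      π.injective.comp <| (minPos_strictMono n).injective.comp τ.injective
  have hq : StrictMono fun k => π (π (minPos (τ k))) := fun j k hjk =>
    (not_lt.1 <| not_apply_lt_apply_of_forall_312 h h132 h312 (hup j).1 (hr hjk)
      (hup k).2).lt_of_ne <| π.injective.ne (hr hjk).ne
  obtain ⟨α, hα, hmid, hmax⟩ := exists_midPos_eq_and_maxPos_eq hq hr (h.bijective_elim h132 τ)
    fun k => h312 _ (τ k).isLt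
  refine ⟨α, hα, τ, Equiv.ext fun y => ?_⟩
  rcases eq_minPos_or_eq_midPos_or_eq_maxPos (mem_ballot.1 hα).1 τ y with
    ⟨k, rfl⟩ | ⟨k, rfl⟩ | ⟨k, rfl⟩
  · rw [permOfCode_minPos, hmax]
  · rw [permOfCode_midPos, hmid, h.apply_apply_apply]
  · rw [permOfCode_maxPos, hmid, hmax]

theorem ncard_setA (n : ℕ) :
    (setA n).ncard = ∑ α ∈ ballot n, (avJoined n (joinedAt α)).ncard := by
  let f (z : Σ α : ballot n, avJoined n (joinedAt α.1)) : setA n :=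
    ⟨permOfCode (mem_ballot.1 z.1.2).1 z.2,
      (permOfCode_mem_setA_iff _ _ (mem_ballot.1 z.1.2).2).2 z.2.2⟩
  have hf : Function.Bijective f := by
    refine ⟨fun ⟨⟨α, hα⟩, ⟨τ, hτ⟩⟩ ⟨⟨β, hβ⟩, ⟨σ, hσ⟩⟩ h => ?_, fun ⟨π, hπ⟩ => ?_⟩
    · obtain ⟨rfl, rfl⟩ := permOfCode_inj (congrArg Subtype.val h)
      rfl
    · obtain ⟨α, hα, τ, rfl⟩ := exists_permOfCode_eq hπ
      exact ⟨⟨⟨α, hα⟩, ⟨τ, (permOfCode_mem_setA_iff _ _ (mem_ballot.1 hα).2).1 hπ⟩⟩, rfl⟩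
  rw [← Nat.card_coe_set_eq, ← Nat.card_eq_of_bijective f hf, Nat.card_sigma,
    ← Finset.sum_coe_sort (ballot n)]
  rfl

theorem ncard_setA_succ (n : ℕ) : (setA (n + 1)).ncard = pathPerms 0 n := by
  rw [ncard_setA, sum_ballot]

section GeneratingFunctions

open PowerSeries

theorem coeff_seriesA_succ (n : ℕ) : coeff (n + 1) seriesA = ((setA (n + 1)).ncard : ℚ) := by
  rw [seriesA_eq, coeff_succ_X_mul, pathPermsGF, coeff_mk, ncard_setA_succ]

theorem constantCoeff_seriesA : constantCoeff seriesA = 0 := by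
  rw [seriesA_eq, map_mul, constantCoeff_X, zero_mul]

/-- The generating function of the sequence `(run n 0).ncard`, which counts the
compositions of `n` with each part `x` weighted by `(setA x).ncard`. -/
noncomputable def runGF : PowerSeries ℚ := PowerSeries.mk fun n => ((run n 0).ncard : ℚ)

theorem constantCoeff_runGF : constantCoeff runGF = 1 := by
  rw [← coeff_zero_eq_constantCoeff_apply, runGF, coeff_mk, ncard_run_zero_zero, Nat.cast_one]

theorem runGF_eq : runGF = 1 + seriesA * runGF := by
  ext n
  rcases n with _ | n
  · simp [constantCoeff_runGF, constantCoeff_seriesA]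
  · rw [map_add, coeff_mul, Finset.Nat.sum_antidiagonal_eq_sum_range_succ_mk,
      Finset.sum_range_succ', coeff_zero_eq_constantCoeff_apply, constantCoeff_seriesA,
      runGF, coeff_mk, ncard_run_zero_succ]
    simp [coeff_one, coeff_seriesA_succ]

theorem runGF_eq_inv : runGF = (1 - seriesA)⁻¹ := by
  rw [PowerSeries.eq_inv_iff_mul_eq_one (by simp [constantCoeff_seriesA])]
  linear_combination runGF_eq

theorem seriesB_eq : seriesB = 2 * (runGF - 1) := by
  ext n
  rw [← map_ofNat (C : ℚ →+* PowerSeries ℚ) 2, coeff_C_mul]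
  rcases n with _ | n
  · simp [seriesB, constantCoeff_runGF]
  · simp [seriesB, runGF, coeff_one, ncard_avStar (Nat.succ_ne_zero n)]

end GeneratingFunctions

end ThreeCyclePerm

theorem theorem132 :
    (∀ n : ℕ, 1 ≤ n →
      (ThreeCyclePerm.avStar n ThreeCyclePerm.pattern132).ncard =
        2 * ∑ x : Composition n, ∏ i : Fin x.length, (ThreeCyclePerm.setA (x.blocksFun i)).ncard) ∧
    ThreeCyclePerm.seriesB =
      2 * ThreeCyclePerm.seriesA * (1 - ThreeCyclePerm.seriesA)⁻¹ := by
  refine ⟨fun n hn => ?_, ?_⟩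
  · rw [ThreeCyclePerm.ncard_avStar (Nat.ne_zero_of_lt hn), ThreeCyclePerm.ncard_run_zero_eq_sum]
  · rw [ThreeCyclePerm.seriesB_eq, ← ThreeCyclePerm.runGF_eq_inv]
    linear_combination 2 * ThreeCyclePerm.runGF_eq
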